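/- **Setting.** Let $\Omega\subset\mathbb R^3$ be an open cuboid with a Cartesian (tensor-product) cuboidal mesh $\mathcal T_h$, where $h$ is the maximal edge length and every edge of the mesh has length at least $h/\rho$. Let $\Gamma\subset\Omega$ be a closed $C^2$ surface that separates $\Omega$ into two open sets $\Omega^-$ and $\Omega^+$: they are disjoint, $\Omega\setminus\Gamma=\Omega^-\cup\Omega^+$, and $\Gamma$ lies in the closure of each. Let $0<\beta^-\le\beta^+$. Let $r_\Gamma$ be the reach of $\Gamma$ (the supremum of the $r>0$ for which the segments of length $2r$ centred at the points of $\Gamma$ and perpendicular to $\Gamma$ are pairwise disjoint), and let $\kappa$ be the maximal absolute principal curvature of $\Gamma$. Assume that (H1) $h<r_\Gamma/(3\sqrt3)$; (H2) $h\kappa\le 0.0288$; (H3) $\Gamma$ meets every mesh edge in at most one point; (H4) $\Gamma$ meets at most two edges of every mesh face. **The operator.** Let $T\in\mathcal T_h$. An intersection point of $T$ is a point of $\Gamma$ on an edge of $T$ whose endpoints lie on different sides of $\Gamma$. Choose a nondegenerate triangle whose vertices are intersection points of $T$ and whose angles are at most $135^\circ$. Let $\tau_T$ be its plane, $F$ its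 centroid and $\bar{\mathbf n}$ a unit normal vector of $\tau_T$. Let $\mathbb Q_1=\mathrm{Span}\{1,x,y,z,xy,xz,yz,xyz\}$. The discrete extension operator $\mathcal C_T:\mathbb Q_1\to\mathbb Q_1$ maps $p$ to the polynomial $q=\mathcal C_T(p)$ such that $p=q$ on $\tau_T$, the coefficients of $xy,xz,yz,xyz$ in $p$ and in $q$ agree, and $\beta^-\nabla p(F)\cdot\bar{\mathbf n}=\beta^+\nabla q(F)\cdot\bar{\mathbf n}$. **Configurations.** Label the vertices of $T$, up to a symmetry of the cube, by $A_1=(0,0,0)$, $A_2=(1,0,0)$, $A_3=(0,1,0)$, $A_4=(1,1,0)$, $A_5=(0,0,1)$, $A_6=(1,0,1)$, $A_7=(0,1,1)$, $A_8=(1,1,1)$ in rescaled coordinates. Each vertex is off $\Gamma$, on one of its two sides, and $A_1$ and $A_8$ are on different sides. Let $T_1$ and $T_2$ be the parts of $T$ on the side of $A_1$ and of $A_8$, respectively. $T$ is of * Type I if $A_1$ is the only vertex on its side (three intersection points); * Type II if exactly $A_1,A_5$ are on the side of $A_1$ (four intersection points, on two pairs of adjacent edges); * Type III if exactly $A_1,A_3,A_5,A_7$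 are on the side of $A_1$ (four intersection points $D_1,D_2,D_3,D_4$, on the parallel edges $A_1A_2$, $A_5A_6$, $A_7A_8$, $A_3A_4$); * Type IV if exactly $A_1,A_2,A_3$ are on the side of $A_1$ (five intersection points); * Type V if exactly $A_1,A_2,A_3,A_5$ are on the side of $A_1$ (six intersection points). **Theorem.** For every $\rho$ there is a constant $C>0$ that depends only on $\rho$ (not on $\Omega$, on the mesh, on $h$, on $\Gamma$ and its position relative to $T$, on the triangle or on $\beta^\pm$) such that in the above setting, for every element $T$ and every such triangle, $\mathcal C_T$ is a well-defined linear bijection of $\mathbb Q_1$, and the following holds, whichever of $\Omega^-,\Omega^+$ contains $T_1$. 1. If $T$ is of Type I, II, IV or V, or of Type III with $|A_4D_4|\ge\frac12|A_4A_3|$ or $|A_2D_1|\ge\frac12|A_2A_1|$ or $|A_6D_2|\ge\frac12|A_6A_5|$ or $|A_8D_3|\ge\frac12|A_8A_7|$, then for $j=0,1$ and all $p\in\mathbb Q_1$ $$|\mathcal C_T(p)|_{H^j(T_2)}\le C\,|p|_{H^j(T_2)},\qquad |\mathcal C_T^{-1}(p)|_{H^j(T_2)}\le C\,\frac{\beta^+}{\beta^-}\,|p|_{H^j(T_2)}.$$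 2. If $T$ is of Type V, or of Type III with $|A_4D_4|\le\frac12|A_4A_3|$ or $|A_2D_1|\le\frac12|A_2A_1|$ or $|A_6D_2|\le\frac12|A_6A_5|$ or $|A_8D_3|\le\frac12|A_8A_7|$, then for $j=0,1$ and all $p\in\mathbb Q_1$ $$|\mathcal C_T(p)|_{H^j(T_1)}\le C\,|p|_{H^j(T_1)},\qquad |\mathcal C_T^{-1}(p)|_{H^j(T_1)}\le C\,\frac{\beta^+}{\beta^-}\,|p|_{H^j(T_1)}.$$ Here $|\cdot|_{H^0(S)}$ is the $L^2(S)$ norm and $|p|_{H^1(S)}=\|\nabla p\|_{L^2(S)}$. -/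

import Mathlib

open scoped InnerProductSpace Gradient ENNReal
open MeasureTheory

noncomputable section

namespace ImmersedFE

/-- Three-dimensional Euclidean space. -/
abbrev E3 : Type := EuclideanSpace ℝ (Fin 3)

/-! ### Closed surfaces, normals, curvature, reach -/

/-- On the open set `U`, the set `Γ` is the zero set of the `C²` function `φ`, and the gradient of
`φ` does not vanish at the points of `Γ` in `U`. -/
structure IsDefiningFunction (Γ U : Set E3) (φ : E3 → ℝ) : Prop where
  isOpen : IsOpen U
  contDiffOn : ContDiffOn ℝ 2 φ U
  mem_iff : ∀ X ∈ U, X ∈ Γ ↔ φ X = 0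
  gradient_ne_zero : ∀ X ∈ U, X ∈ Γ → ∇ φ X ≠ 0

/-- A closed (compact, without boundary) embedded `C²` surface in space. -/
def IsClosedC2Surface (Γ : Set E3) : Prop :=
  IsCompact Γ ∧ ∀ X ∈ Γ, ∃ U φ, X ∈ U ∧ IsDefiningFunction Γ U φ

/-- `ν` is a unit normal vector to `Γ` at `X`. -/
def IsUnitNormal (Γ : Set E3) (X ν : E3) : Prop :=
  ‖ν‖ = 1 ∧ ∃ U φ, X ∈ U ∧ IsDefiningFunction Γ U φ ∧ ∃ c : ℝ, ν = c • ∇ φ X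

/-- `N_X(r)`: the segment of length `2 r` centred at `X` and perpendicular to `Γ`. -/
def normalSegment (Γ : Set E3) (X : E3) (r : ℝ) : Set E3 :=
  {Z | ∃ ν t, IsUnitNormal Γ X ν ∧ |t| ≤ r ∧ Z = X + t • ν}

/-- The reach of `Γ`: the supremum of the `r > 0` for which the normal segments `N_X(r)`, `X ∈ Γ`,
are pairwise disjoint. -/
def reach (Γ : Set E3) : ℝ≥0∞ :=
  sSup {R | ∃ r : ℝ, 0 < r ∧ R = ENNReal.ofReal r ∧
    ∀ X ∈ Γ, ∀ Y ∈ Γ, X ≠ Y → Disjoint (normalSegment Γ X r) (normalSegment Γ Y r)}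

/-- The maximal absolute value of the principal curvatures of `Γ`, that is, the supremum of the
absolute normal curvatures `|D²φ(X)(v, v)| / ‖∇φ(X)‖` over the points `X` of `Γ` and the unit
tangent vectors `v` at `X`. -/
def maxCurvature (Γ : Set E3) : ℝ≥0∞ :=
  sSup {K | ∃ X ∈ Γ, ∃ U φ v, X ∈ U ∧ IsDefiningFunction Γ U φ ∧ ‖v‖ = 1 ∧ ⟪∇ φ X, v⟫_ℝ = 0 ∧
    K = ENNReal.ofReal (|fderiv ℝ (fderiv ℝ φ) X v v| / ‖∇ φ X‖)}

/-! ### Cuboids and Cartesian meshes -/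

/-- A nondegenerate closed cuboid with edges parallel to the axes. -/
structure Cuboid where
  lo : Fin 3 → ℝ
  hi : Fin 3 → ℝ
  lo_lt_hi : ∀ i, lo i < hi i

namespace Cuboid

/-- The points of the cuboid. -/
def carrier (T : Cuboid) : Set E3 := {X | ∀ i, X i ∈ Set.Icc (T.lo i) (T.hi i)}

/-- The eight vertices, indexed by `{false, true}³`. -/
def vertex (T : Cuboid) (b : Fin 3 → Bool) : E3 :=
  WithLp.toLp 2 fun i => if b i then T.hi i else T.lo i

/-- For `b d = false`, the closed edge in direction `d` that starts at the vertex `b`. -/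
def edge (T : Cuboid) (d : Fin 3) (b : Fin 3 → Bool) : Set E3 :=
  segment ℝ (T.vertex b) (T.vertex (Function.update b d true))

/-- The edges (encoded as in `edge`) of the face `x_i = lo i` (`c = false`) or `x_i = hi i`
(`c = true`) that meet the set `Γ`. -/
def faceEdgesMeeting (T : Cuboid) (i : Fin 3) (c : Bool) (Γ : Set E3) :
    Set (Fin 3 × (Fin 3 → Bool)) :=
  {e | e.2 e.1 = false ∧ e.1 ≠ i ∧ e.2 i = c ∧ (Γ ∩ T.edge e.1 e.2).Nonempty}

end Cuboid

/-- A Cartesian cuboidal mesh: the tensor product of a partition of an interval on each axis. -/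
structure CartesianMesh where
  n : Fin 3 → ℕ
  n_pos : ∀ i, 0 < n i
  node : (i : Fin 3) → Fin (n i + 1) → ℝ
  strictMono : ∀ i, StrictMono (node i)

namespace CartesianMesh

/-- The open cuboid that is meshed. -/
def domain (M : CartesianMesh) : Set E3 :=
  {X | ∀ i, X i ∈ Set.Ioo (M.node i 0) (M.node i (Fin.last _))}

/-- The length of the `k`-th interval on axis `i`. -/
def len (M : CartesianMesh) (i : Fin 3) (k : Fin (M.n i)) : ℝ :=
  M.node i k.succ - M.node i k.castSucc

/-- The mesh size: the maximal edge length (a supremum over a finite nonempty set). -/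
def size (M : CartesianMesh) : ℝ := ⨆ e : (i : Fin 3) × Fin (M.n i), M.len e.1 e.2

/-- The elements of the mesh. -/
def element (M : CartesianMesh) (k : (i : Fin 3) → Fin (M.n i)) : Cuboid where
  lo i := M.node i (k i).castSucc
  hi i := M.node i (k i).succ
  lo_lt_hi i := M.strictMono i (Fin.castSucc_lt_succ)

/-- All edge lengths are comparable to the mesh size, with ratio at most `ρ`. -/
def ShapeRegular (M : CartesianMesh) (ρ : ℝ) : Prop := ∀ i k, M.size ≤ ρ * M.len i k

end CartesianMesh

/-! ### The interface -/

/-- The closed `C²` surface `Γ` in `Ω` separates `Ω` into the two open sets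
`Ω⁻ = side false` and `Ω⁺ = side true`. -/
structure IsInterface (Ω Γ : Set E3) (side : Bool → Set E3) : Prop where
  surface : IsClosedC2Surface Γ
  subset : Γ ⊆ Ω
  isOpen : ∀ s, IsOpen (side s)
  disjoint : Disjoint (side false) (side true)
  union : side false ∪ side true = Ω \ Γ
  subset_closure : ∀ s, Γ ⊆ closure (side s)

/-- The interface is resolved by the mesh. -/
structure IsResolved (M : CartesianMesh) (Γ : Set E3) : Prop where
  /-- `h < r_Γ / (3 √3)` -/
  reach_bound : ENNReal.ofReal (3 * √3 * M.size) < reach Γ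
  /-- `h κ ≤ 0.0288` -/
  curvature_bound : ENNReal.ofReal M.size * maxCurvature Γ ≤ ENNReal.ofReal 0.0288
  /-- `Γ` meets every edge of the mesh in at most one point. -/
  edge_bound : ∀ k d b, b d = false → (Γ ∩ (M.element k).edge d b).Subsingleton
  /-- `Γ` meets at most two edges of every face of the mesh. -/
  face_bound : ∀ k i c, ((M.element k).faceEdgesMeeting i c Γ).ncard ≤ 2

/-- `X` (a point of the closed domain) lies off the interface, on side `s` of it. The closure is
taken because a mesh node may lie on the boundary of the domain, which `Γ` does not meet. -/
def OnSide (Γ : Set E3) (side : Bool → Set E3) (s : Bool) (X : E3) : Prop :=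
  X ∈ closure (side s) ∧ X ∉ Γ

/-- `D` is an intersection point of `T`: it lies on `Γ` and on an interface edge of `T`, that is,
on an edge whose endpoints are on different sides. -/
def IsInterfacePoint (Γ : Set E3) (side : Bool → Set E3) (T : Cuboid) (D : E3) : Prop :=
  ∃ d b s, b d = false ∧ OnSide Γ side s (T.vertex b) ∧
    OnSide Γ side (!s) (T.vertex (Function.update b d true)) ∧ D ∈ Γ ∩ T.edge d b

/-- The three points `P` form a triangle that may be used to define the approximating plane:
its vertices are intersection points of `T`, it is nondegenerate, and its angles are at most
135 degrees. -/
structure IsAdmissibleTriangle (Γ : Set E3) (side : Bool → Set E3) (T : Cuboid)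
    (P : Fin 3 → E3) : Prop where
  interfacePoint : ∀ j, IsInterfacePoint Γ side T (P j)
  affineIndependent : AffineIndependent ℝ P
  angle_le : ∀ i j k, i ≠ j → j ≠ k → i ≠ k →
    EuclideanGeometry.angle (P i) (P j) (P k) ≤ 3 * Real.pi / 4

/-- The approximating plane `τ_T` through the triangle `P`. -/
def plane (P : Fin 3 → E3) : AffineSubspace ℝ E3 := affineSpan ℝ (Set.range P)

/-- The centroid `F` of the triangle `P`. -/
def triCentroid (P : Fin 3 → E3) : E3 := (1 / 3 : ℝ) • (P 0 + P 1 + P 2)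

/-- `ν` is a unit normal vector of the plane `τ_T`. -/
def IsPlaneNormal (P : Fin 3 → E3) (ν : E3) : Prop :=
  ‖ν‖ = 1 ∧ ∀ v ∈ (plane P).direction, ⟪v, ν⟫_ℝ = 0

/-! ### Configurations of interface elements -/

/-- The reference label of `A₁`; those of `A₂, …, A₈` follow. -/
abbrev a1 : Fin 3 → Bool := ![false, false, false]
abbrev a2 : Fin 3 → Bool := ![true, false, false]
abbrev a3 : Fin 3 → Bool := ![false, true, false]
abbrev a4 : Fin 3 → Bool := ![true, true, false]
abbrev a5 : Fin 3 → Bool := ![false, false, true]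
abbrev a6 : Fin 3 → Bool := ![true, false, true]
abbrev a7 : Fin 3 → Bool := ![false, true, true]
abbrev a8 : Fin 3 → Bool := ![true, true, true]

/-- A labelling of the vertices of a cuboid as `A₁, …, A₈`: the reference labelling, up to a
symmetry of the cube (a permutation of the axes followed by reflections). -/
structure Labelling where
  perm : Equiv.Perm (Fin 3)
  flip : Fin 3 → Bool

/-- The vertex of `T` with reference label `b` in the labelling `g`. -/
def Labelling.vertex (g : Labelling) (T : Cuboid) (b : Fin 3 → Bool) : E3 :=
  T.vertex fun i => xor (g.flip i) (b (g.perm i))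

/-- The five configurations of interface elements:
* `I`: three intersection points, on the three edges at `A₁`;
* `II`: four intersection points on two pairs of adjacent edges (the edge `A₁A₅` is cut off);
* `III`: four intersection points on the four parallel edges `A₁A₂, A₃A₄, A₅A₆, A₇A₈`;
* `IV`: five intersection points (`A₁, A₂, A₃` are cut off);
* `V`: six intersection points (`A₁, A₂, A₃, A₅` are separated from `A₄, A₆, A₇, A₈`). -/
inductive Config
  | I
  | II
  | III
  | IV
  | V

/-- The labels of the vertices that are on the same side of the interface as `A₁`. -/
def Config.firstVertices : Config → Set (Fin 3 → Bool)
  | .I => {a1}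
  | .II => {a1, a5}
  | .III => {a1, a3, a5, a7}
  | .IV => {a1, a2, a3}
  | .V => {a1, a2, a3, a5}

/-- With the labelling `g`, the element `T` has configuration `c`, and its vertex `A₁` is on side
`s` of the interface (and `A₈` on the other side). -/
def HasConfig (Γ : Set E3) (side : Bool → Set E3) (T : Cuboid) (g : Labelling) (s : Bool)
    (c : Config) : Prop :=
  ∀ b, (b ∈ c.firstVertices → OnSide Γ side s (g.vertex T b)) ∧
    (b ∉ c.firstVertices → OnSide Γ side (!s) (g.vertex T b))

/-- The edges `A₂A₁, A₄A₃, A₆A₅, A₈A₇`, which carry the intersection points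
`D₁, D₄, D₂, D₃` in configuration `III`. -/
def parallelEdges : Set ((Fin 3 → Bool) × (Fin 3 → Bool)) :=
  {(a2, a1), (a4, a3), (a6, a5), (a8, a7)}

/-- `|A₄D₄| ≥ |A₄A₃| / 2` or `|A₂D₁| ≥ |A₂A₁| / 2` or `|A₆D₂| ≥ |A₆A₅| / 2` or
`|A₈D₃| ≥ |A₈A₇| / 2`. -/
def SomeCutFar (Γ : Set E3) (T : Cuboid) (g : Labelling) : Prop :=
  ∃ e ∈ parallelEdges, ∃ D ∈ Γ ∩ segment ℝ (g.vertex T e.1) (g.vertex T e.2),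
    1 / 2 * dist (g.vertex T e.1) (g.vertex T e.2) ≤ dist (g.vertex T e.1) D

/-- `|A₄D₄| ≤ |A₄A₃| / 2` or `|A₂D₁| ≤ |A₂A₁| / 2` or `|A₆D₂| ≤ |A₆A₅| / 2` or
`|A₈D₃| ≤ |A₈A₇| / 2`. -/
def SomeCutNear (Γ : Set E3) (T : Cuboid) (g : Labelling) : Prop :=
  ∃ e ∈ parallelEdges, ∃ D ∈ Γ ∩ segment ℝ (g.vertex T e.1) (g.vertex T e.2),
    dist (g.vertex T e.1) D ≤ 1 / 2 * dist (g.vertex T e.1) (g.vertex T e.2)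

/-! ### Trilinear polynomials and the approximate jump conditions -/

/-- Trilinear polynomials: degree at most one in each of the three variables. -/
abbrev Q1 : Submodule ℝ (MvPolynomial (Fin 3) ℝ) := MvPolynomial.restrictDegree (Fin 3) ℝ 1

/-- The value of a polynomial at a point. -/
def val (p : MvPolynomial (Fin 3) ℝ) (X : E3) : ℝ := MvPolynomial.eval (fun i => X i) p

/-- The gradient of a polynomial at a point. -/
def grad (p : MvPolynomial (Fin 3) ℝ) (X : E3) : E3 :=
  WithLp.toLp 2 fun i => val (MvPolynomial.pderiv i p) X

/-- The exponent of the monomial `∏_{i ∈ S} x_i`. -/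
def expo (S : Finset (Fin 3)) : Fin 3 →₀ ℕ := ∑ i ∈ S, Finsupp.single i 1

/-- The polynomials `p` (on `T⁻`) and `q` (on `T⁺`) satisfy the approximate jump conditions. -/
structure SatisfiesJump (βm βp : ℝ) (P : Fin 3 → E3) (ν : E3) (p q : Q1) : Prop where
  /-- `p = q` on `τ_T` -/
  trace : ∀ X ∈ plane P, val p X = val q X
  /-- the coefficients of `xy`, `xz`, `yz`, `xyz` agree -/
  coeff : ∀ S : Finset (Fin 3), 2 ≤ S.card →
    MvPolynomial.coeff (expo S) (p : MvPolynomial (Fin 3) ℝ) =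
      MvPolynomial.coeff (expo S) (q : MvPolynomial (Fin 3) ℝ)
  /-- `β⁻ ∇p(F) · ν = β⁺ ∇q(F) · ν` -/
  flux : βm * ⟪grad p (triCentroid P), ν⟫_ℝ = βp * ⟪grad q (triCentroid P), ν⟫_ℝ

/-- `𝒞` is the discrete extension operator: `𝒞 p` is the only trilinear polynomial that together
with `p` satisfies the approximate jump conditions. -/
def IsExtensionOperator (βm βp : ℝ) (P : Fin 3 → E3) (ν : E3) (𝒞 : Q1 ≃ₗ[ℝ] Q1) : Prop :=
  ∀ p q, SatisfiesJump βm βp P ν p q ↔ q = 𝒞 p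

/-- The seminorm `|p|_{H^j(S)}` of a polynomial, `j = 0, 1`. -/
def sobolevSeminorm (j : Fin 2) (S : Set E3) (p : MvPolynomial (Fin 3) ℝ) : ℝ :=
  match j with
  | 0 => √(∫ X in S, val p X ^ 2)
  | 1 => √(∫ X in S, ‖grad p X‖ ^ 2)

/-- Stability of `𝒞` and of its inverse on `S` in the seminorms of `H⁰` and `H¹`. -/
def IsStableOn (K βm βp : ℝ) (𝒞 : Q1 ≃ₗ[ℝ] Q1) (S : Set E3) : Prop :=
  ∀ (j : Fin 2) (p : Q1),
    sobolevSeminorm j S (𝒞 p) ≤ K * sobolevSeminorm j S p ∧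
    sobolevSeminorm j S (𝒞.symm p) ≤ K * (βp / βm) * sobolevSeminorm j S p

end ImmersedFE

end

open ImmersedFE

/-!
The extension operator has a closed form: `𝒞 p = p + (β⁻/β⁺ - 1) (∇p(F) · ν) L` with
`L(X) = (X - F) · ν`. Indeed `𝒞 p - p` is affine and vanishes on the plane, so it is a multiple of
`L`, and the flux condition gives the factor (`isExtensionOperator_scaleNormalEquiv`). The inverse
has the same form with `β⁺/β⁻` in place of `β⁻/β⁺`.

Stability on a part `S` of the element therefore amounts to bounds of `|∇p(F)|² |S|` by the integral
of `|∇p|²` over `S`, and of `h² |∇p(F)|² |S|` by the integral of `p²`. These are inverse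
inequalities, and since `F` lies in the element they hold as soon as `S` contains a ball of radius
comparable to `h` (`IsMultiaffine.sq_mul_volume_le`, `sobolevSeminorm_scaleNormal_le`): a function
that is affine in each variable is interpolated at the vertices of a small cube in this ball, and
the bound is averaged over the positions of the cube.

What remains is geometric: `S` contains such a ball. Since the reach exceeds `R = 3 √3 h`, the two
balls of radius `R` that touch the surface at a point do not meet the surface, and they lie on
different sides of it (`Separates.tangent_ball_subset`). As opposite balls at two points are
disjoint, the unit normal is Lipschitz with constant `1 / R`
(`norm_sub_le_of_disjoint_balls`), so that it varies by little more than `1/3` over the element.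
It follows that a side of the interface that meets, for every axis, both halves of the element has
a large ball in the element (`Separates.exists_ball_subset`): some component of the normal is at
least `0.57` at one point, keeps its sign over the element, and moving in its direction from a point
of the side with enough room leads deep into a ball that touches the surface. The listed
configurations are such that vertices of the side in question, together with the cut point `D` on
one of the parallel edges in configuration `III`, meet both halves for every axis.
-/

namespace ImmersedFE
open Metric Topology

/-! ### Nearest points and tangent balls -/

lemma IsDefiningFunction.hasStrictFDerivAt {Γ U : Set E3} {φ : E3 → ℝ}
    (h : IsDefiningFunction Γ U φ) {X : E3} (hX : X ∈ U) :
    HasStrictFDerivAt φ (innerSL ℝ (∇ φ X)) X := by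
  have h1 : ContDiffAt ℝ 2 φ X := h.contDiffOn.contDiffAt (h.isOpen.mem_nhds hX)
  have h2 := h1.hasStrictFDerivAt (by norm_num)
  have h3 : innerSL ℝ (∇ φ X) = fderiv ℝ φ X := by
    ext y
    simp [inner_gradient_left]
  rwa [h3]

lemma IsUnitNormal.neg {Γ : Set E3} {X ν : E3} (h : IsUnitNormal Γ X ν) :
    IsUnitNormal Γ X (-ν) := by
  obtain ⟨h1, U, φ, hX, hφ, c, rfl⟩ := h
  exact ⟨by rwa [norm_neg], U, φ, hX, hφ, -c, by rw [neg_smul]⟩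

lemma IsClosedC2Surface.exists_isUnitNormal {Γ : Set E3} (hΓ : IsClosedC2Surface Γ) {X : E3}
    (hX : X ∈ Γ) : ∃ ν, IsUnitNormal Γ X ν := by
  obtain ⟨U, φ, hXU, hφ⟩ := hΓ.2 X hX
  refine ⟨‖∇ φ X‖⁻¹ • ∇ φ X, ?_, U, φ, hXU, hφ, _, rfl⟩
  exact norm_smul_inv_norm (𝕜 := ℝ) (hφ.gradient_ne_zero X hXU hX)

/-- By the Lagrange multiplier rule, the vector to a point from a nearest point of the surface is
normal to the surface. -/
lemma IsClosedC2Surface.exists_isUnitNormal_of_nearest {Γ : Set E3} (hΓ : IsClosedC2Surface Γ)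
    {X Z : E3} (hX : X ∈ Γ) (hmin : ∀ Y ∈ Γ, dist Z X ≤ dist Z Y) :
    ∃ ν, IsUnitNormal Γ X ν ∧ Z = X + dist Z X • ν := by
  rcases eq_or_ne Z X with rfl | hZX
  · obtain ⟨ν, hν⟩ := hΓ.exists_isUnitNormal hX
    exact ⟨ν, hν, by simp⟩
  obtain ⟨U, φ, hXU, hφ⟩ := hΓ.2 X hX
  have hf : HasStrictFDerivAt (fun Y : E3 => ‖Y - Z‖ ^ 2)
      (2 • (innerSL ℝ (X - Z)).comp (ContinuousLinearMap.id ℝ E3)) X :=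
    (hasStrictFDerivAt_norm_sq (X - Z)).comp X ((hasStrictFDerivAt_id X).sub_const Z)
  have hext : IsLocalExtrOn (fun Y : E3 => ‖Y - Z‖ ^ 2) {Y | φ Y = φ X} X := by
    refine Or.inl ?_
    have hU : U ∈ 𝓝[{Y | φ Y = φ X}] X := mem_nhdsWithin_of_mem_nhds (hφ.isOpen.mem_nhds hXU)
    filter_upwards [hU, self_mem_nhdsWithin] with Y hY hYX
    have hYΓ : Y ∈ Γ := (hφ.mem_iff Y hY).2 (hYX.trans ((hφ.mem_iff X hXU).1 hX))
    have := hmin Y hYΓ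
    rw [dist_comm Z X, dist_comm Z Y, dist_eq_norm, dist_eq_norm] at this
    gcongr
  obtain ⟨a, b, hab, h⟩ :=
    hext.exists_multipliers_of_hasStrictFDerivAt_1d (hφ.hasStrictFDerivAt hXU) hf
  have hvec : a • ∇ φ X + (2 * b) • (X - Z) = 0 := by
    refine ext_inner_right ℝ fun v => ?_
    have := DFunLike.congr_fun h v
    simp only [inner_add_left, inner_smul_left, inner_zero_left, add_apply,
      smul_apply, ContinuousLinearMap.comp_apply, innerSL_apply_apply,
      ContinuousLinearMap.id_apply, zero_apply, smul_eq_mul, nsmul_eq_mul,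
      Nat.cast_ofNat, conj_trivial] at this ⊢
    linarith
  have hb : b ≠ 0 := by
    rintro rfl
    have ha : a ≠ 0 := by rintro rfl; exact hab rfl
    have : a • ∇ φ X = 0 := by simpa using hvec
    exact hφ.gradient_ne_zero X hXU hX ((smul_eq_zero.1 this).resolve_left ha)
  have hd : dist Z X ≠ 0 := dist_ne_zero.2 hZX
  refine ⟨(dist Z X)⁻¹ • (Z - X), ⟨?_, U, φ, hXU, hφ, (dist Z X)⁻¹ * (a / (2 * b)), ?_⟩, ?_⟩
  · rw [dist_eq_norm]
    exact norm_smul_inv_norm (𝕜 := ℝ) (sub_ne_zero.2 hZX)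
  · have : Z - X = (a / (2 * b)) • ∇ φ X := by
      have h3 : (2 * b) • (Z - X) = a • ∇ φ X := by
        rw [← sub_eq_zero, ← neg_eq_zero, ← hvec]; module
      rw [div_eq_inv_mul, mul_smul, ← h3, smul_smul, inv_mul_cancel₀ (by positivity), one_smul]
    rw [this, smul_smul]
  · rw [smul_smul, mul_inv_cancel₀ hd, one_smul, add_sub_cancel]

/-- The normal segments `N_X(R)` of the surface are pairwise disjoint. -/
def HasDisjointNormals (Γ : Set E3) (R : ℝ) : Prop :=
  ∀ X ∈ Γ, ∀ Y ∈ Γ, X ≠ Y → Disjoint (normalSegment Γ X R) (normalSegment Γ Y R)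

lemma hasDisjointNormals_of_lt_reach {Γ : Set E3} {R : ℝ} (h : ENNReal.ofReal R < reach Γ) :
    HasDisjointNormals Γ R := by
  obtain ⟨_, ⟨r, _, rfl, hr⟩, hlt⟩ := lt_sSup_iff.1 h
  have hRr : R ≤ r := (ENNReal.ofReal_lt_ofReal_iff'.1 hlt).1.le
  have hsub : ∀ X, normalSegment Γ X R ⊆ normalSegment Γ X r := by
    rintro X Z ⟨ν, t, hν, ht, rfl⟩
    exact ⟨ν, t, hν, ht.trans hRr, rfl⟩
  exact fun X hX Y hY hXY => (hr X hX Y hY hXY).mono (hsub X) (hsub Y)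

/-- If the normal segments of length `R` do not meet each other, the balls of radius `R` that touch
the surface do not meet the surface: the point of the surface nearest to the centre of such a ball
is the point of contact. -/
lemma HasDisjointNormals.ball_disjoint {Γ : Set E3} {R : ℝ} (hN : HasDisjointNormals Γ R)
    (hΓ : IsClosedC2Surface Γ) (hR : 0 ≤ R) {X ν : E3} (hX : X ∈ Γ) (hν : IsUnitNormal Γ X ν) :
    Disjoint (ball (X + R • ν) R) Γ := by
  obtain ⟨Y, hY, hmin⟩ := hΓ.1.exists_infDist_eq_dist ⟨X, hX⟩ (X + R • ν)
  have hmin' : ∀ W ∈ Γ, dist (X + R • ν) Y ≤ dist (X + R • ν) W := fun W hW =>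
    hmin ▸ infDist_le_dist_of_mem hW
  have hdX : dist (X + R • ν) X = R := by
    rw [dist_eq_norm, add_sub_cancel_left, norm_smul, hν.1, mul_one, Real.norm_of_nonneg hR]
  have hYX : Y = X := by
    by_contra hne
    obtain ⟨μ, hμ, hZ⟩ := hΓ.exists_isUnitNormal_of_nearest hY hmin'
    have hdisj := Set.disjoint_left.1 (hN Y hY X hX hne)
    refine @hdisj (X + R • ν) ?_ ⟨ν, R, hν, ?_, rfl⟩
    · refine ⟨μ, _, hμ, ?_, hZ⟩
      rw [abs_of_nonneg dist_nonneg]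
      exact (hmin' X hX).trans hdX.le
    · rw [abs_of_nonneg hR]
  subst hYX
  refine Set.disjoint_left.2 fun W hW hWΓ => ?_
  have := hmin' W hWΓ
  rw [hdX] at this
  rw [mem_ball, dist_comm] at hW
  exact absurd hW (not_lt.2 this)

/-! ### Separation of the whole space -/

/-- The two disjoint open sets `S false`, `S true` make up the complement of `Γ` in the whole
space, and `Γ` is in the closure of both. -/
structure Separates (Γ : Set E3) (S : Bool → Set E3) : Prop where
  isOpen : ∀ s, IsOpen (S s)
  disjoint : Disjoint (S false) (S true)
  union : S false ∪ S true = Γᶜ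
  subset_closure : ∀ s, Γ ⊆ closure (S s)

namespace Separates

variable {Γ : Set E3} {S : Bool → Set E3}

lemma mem_or (h : Separates Γ S) (s : Bool) {X : E3} (hX : X ∉ Γ) : X ∈ S s ∨ X ∈ S (!s) := by
  have : X ∈ S false ∪ S true := by rw [h.union]; exact hX
  cases s
  · exact this
  · exact this.symm

lemma not_mem (h : Separates Γ S) {s : Bool} {X : E3} (hX : X ∈ S s) : X ∉ Γ := by
  have : X ∈ S false ∪ S true := by
    cases s
    · exact Or.inl hX
    · exact Or.inr hX
  rw [h.union] at this
  exact this

lemma disjoint_not (h : Separates Γ S) (s : Bool) : Disjoint (S s) (S (!s)) := by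
  cases s
  · exact h.disjoint
  · exact h.disjoint.symm

lemma subset_of_isPreconnected (h : Separates Γ S) {C : Set E3} (hC : IsPreconnected C)
    (hCΓ : Disjoint C Γ) {s : Bool} (hs : (C ∩ S s).Nonempty) : C ⊆ S s := by
  refine hC.subset_left_of_subset_union (h.isOpen s) (h.isOpen (!s)) (h.disjoint_not s) ?_ hs
  exact fun X hX => h.mem_or s (Set.disjoint_left.1 hCΓ hX)

lemma closure_subset (h : Separates Γ S) (s : Bool) : closure (S s) ⊆ S s ∪ Γ := by
  intro X hX
  by_contra hn
  rw [Set.mem_union, not_or] at hn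
  have h1 : X ∈ S (!s) := (h.mem_or s hn.2).resolve_left hn.1
  obtain ⟨Y, hY, hY'⟩ := mem_closure_iff.1 hX _ (h.isOpen (!s)) h1
  exact Set.disjoint_left.1 (h.disjoint_not s) hY' hY

/-- The two balls that touch the surface at a point lie on different sides. Points of either side
close to the point of contact can be moved along the normal, in one of its two directions, into
one of the balls without crossing the surface, so that each side meets one of the balls. -/
lemma tangent_ball_subset (h : Separates Γ S) (hΓ : IsClosedC2Surface Γ) {R : ℝ} (hR : 0 < R)
    (hN : HasDisjointNormals Γ R) {X ν : E3} (hX : X ∈ Γ) (hν : IsUnitNormal Γ X ν) {s : Bool}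
    (hs : (ball (X + R • ν) R ∩ S s).Nonempty) :
    ball (X + R • ν) R ⊆ S s ∧ ball (X - R • ν) R ⊆ S (!s) := by
  have hb := hN.ball_disjoint hΓ hR.le hX hν
  have hb' : Disjoint (ball (X - R • ν) R) Γ := by
    have := hN.ball_disjoint hΓ hR.le hX hν.neg
    rwa [smul_neg, ← sub_eq_add_neg] at this
  have hpre : ∀ W : E3, IsPreconnected (ball W R) := fun W => (convex_ball W R).isPreconnected
  have hplus := h.subset_of_isPreconnected (hpre _) hb hs
  refine ⟨hplus, h.subset_of_isPreconnected (hpre _) hb' ?_⟩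
  obtain ⟨hν1, U, φ, hXU, hφ, c, hc⟩ := hν
  set k : ℝ := ⟪∇ φ X, ν⟫_ℝ with hk
  have hk0 : k ≠ 0 := by
    intro h0
    have : ⟪ν, ν⟫_ℝ = 0 := by
      nth_rewrite 1 [hc]
      rw [inner_smul_left, ← hk, h0, mul_zero]
    rw [real_inner_self_eq_norm_sq, hν1] at this
    norm_num at this
  have hlo := (hφ.hasStrictFDerivAt hXU).isLittleO.def (c := |k| / 2) (by positivity)
  rw [nhds_prod_eq] at hlo
  obtain ⟨V, hV, hφV⟩ := Filter.eventually_prod_self_iff'.1 hlo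
  obtain ⟨ε, hε, hεV⟩ := Metric.mem_nhds_iff.1
    (Filter.inter_mem hV (hφ.isOpen.mem_nhds hXU))
  set δ : ℝ := min (ε / 2) R with hδ
  have hδ0 : 0 < δ := lt_min (by linarith) hR
  have hδε : δ ≤ ε / 2 := min_le_left _ _
  have hδR : δ ≤ R := min_le_right _ _
  obtain ⟨Y, hYS, hXY⟩ := Metric.mem_closure_iff.1 (h.subset_closure (!s) hX) δ hδ0
  have hYX : ‖Y - X‖ < δ := by rwa [← dist_eq_norm, dist_comm]
  have hmem : ∀ t : ℝ, |t| ≤ δ → Y + t • ν ∈ V ∧ Y + t • ν ∈ U := by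
    intro t ht
    refine hεV (mem_ball_iff_norm.2 ?_)
    have : Y + t • ν - X = (Y - X) + t • ν := by abel
    rw [this]
    have := norm_add_le (Y - X) (t • ν)
    rw [norm_smul, hν1, mul_one, Real.norm_eq_abs] at this
    linarith
  -- `φ` is injective on the normal line through `Y`, near `X`
  have hinj : ∀ t₁ t₂ : ℝ, |t₁| ≤ δ → |t₂| ≤ δ → Y + t₁ • ν ∈ Γ → Y + t₂ • ν ∈ Γ → t₁ = t₂ := by
    intro t₁ t₂ h1 h2 hΓ1 hΓ2
    have key := hφV _ (hmem t₁ h1).1 _ (hmem t₂ h2).1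
    rw [(hφ.mem_iff _ (hmem t₁ h1).2).1 hΓ1, (hφ.mem_iff _ (hmem t₂ h2).2).1 hΓ2] at key
    have hsub : Y + t₁ • ν - (Y + t₂ • ν) = (t₁ - t₂) • ν := by module
    rw [hsub, map_smul, innerSL_apply_apply, ← hk, norm_smul, hν1, smul_eq_mul, sub_self, zero_sub,
      norm_neg, norm_mul, mul_one, Real.norm_eq_abs, Real.norm_eq_abs] at key
    have hkpos : 0 < |k| := abs_pos.2 hk0
    have : |t₁ - t₂| = 0 := by nlinarith [abs_nonneg (t₁ - t₂)]
    linarith [abs_eq_zero.1 this]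
  have hYΓ : Y ∉ Γ := h.not_mem hYS
  -- one of the two normal segments from `Y` does not meet the surface
  have hmove : ∀ σ : ℝ, (∀ t ∈ Set.Icc 0 δ, Y + (σ * t) • ν ∉ Γ) → Y + (σ * δ) • ν ∈ S (!s) := by
    intro σ hσ
    have hC : IsPreconnected ((fun t : ℝ => Y + (σ * t) • ν) '' Set.Icc 0 δ) :=
      isPreconnected_Icc.image _ (by fun_prop)
    refine h.subset_of_isPreconnected hC ?_ ⟨Y, ⟨0, ⟨le_rfl, hδ0.le⟩, by simp⟩, hYS⟩
      ⟨δ, ⟨hδ0.le, le_rfl⟩, rfl⟩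
    rw [Set.disjoint_left]
    rintro _ ⟨t, ht, rfl⟩
    exact hσ t ht
  have hin : ∀ σ : ℝ, |σ| = 1 → Y + (σ * δ) • ν ∈ ball (X + (σ * R) • ν) R := by
    intro σ hσ
    rw [mem_ball_iff_norm]
    have : Y + (σ * δ) • ν - (X + (σ * R) • ν) = (Y - X) + (σ * (δ - R)) • ν := by module
    rw [this]
    have := norm_add_le (Y - X) ((σ * (δ - R)) • ν)
    rw [norm_smul, hν1, mul_one, Real.norm_eq_abs, abs_mul, hσ, one_mul,
      abs_of_nonpos (by linarith)] at this
    linarith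
  by_cases hup : ∀ t ∈ Set.Icc 0 δ, Y + (1 * t) • ν ∉ Γ
  · have h1 := hmove 1 hup
    have h2 := hin 1 (by simp)
    rw [one_mul R] at h2
    exact absurd h1 (Set.disjoint_left.1 (h.disjoint_not s) (hplus h2))
  · refine ⟨Y + (-1 * δ) • ν, ?_, hmove (-1) ?_⟩
    · have := hin (-1) (by simp)
      rwa [neg_one_mul R, neg_smul, ← sub_eq_add_neg] at this
    · push Not at hup
      obtain ⟨t₁, ht₁, hΓ1⟩ := hup
      intro t ht hΓ2
      have := hinj (1 * t₁) (-1 * t) (by rw [one_mul, abs_of_nonneg ht₁.1]; exact ht₁.2)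
        (by rw [neg_one_mul, abs_neg, abs_of_nonneg ht.1]; exact ht.2) hΓ1 hΓ2
      have h0 : t₁ = 0 := by linarith [ht₁.1, ht.1]
      rw [h0] at hΓ1
      simp at hΓ1
      exact hYΓ hΓ1

end Separates

namespace Separates

variable {Γ : Set E3} {S : Bool → Set E3}

/-- At a point `Z` of side `s` or of the surface, at distance `d < R` from the surface, there is a
unit vector `ν` (normal to the surface at the nearest point `Z - d ν`, and pointing to side `s`)
such that the balls of radius `R` touching the surface at `Z - d ν` are in side `s` and in the
other side. -/
lemma exists_tangent_balls (h : Separates Γ S) (hΓ : IsClosedC2Surface Γ) {R : ℝ} (hR : 0 < R)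
    (hN : HasDisjointNormals Γ R) {s : Bool} {Z : E3} (hZ : Z ∈ closure (S s))
    (hne : Γ.Nonempty) (hd : infDist Z Γ < R) :
    ∃ ν : E3, ‖ν‖ = 1 ∧ ball (Z + (R - infDist Z Γ) • ν) R ⊆ S s ∧
      ball (Z - (R + infDist Z Γ) • ν) R ⊆ S (!s) := by
  obtain ⟨X, hX, hXd⟩ := hΓ.1.exists_infDist_eq_dist hne Z
  obtain ⟨ν, hν, hZX⟩ := hΓ.exists_isUnitNormal_of_nearest hX
    (fun Y hY => hXd ▸ infDist_le_dist_of_mem hY)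
  rw [hXd] at hd ⊢
  set d := dist Z X with hddef
  have hd0 : 0 ≤ d := dist_nonneg
  -- it suffices to find a normal whose ball meets side `s`
  have hfin : ∀ μ : E3, IsUnitNormal Γ X μ → Z = X + d • μ →
      (ball (X + R • μ) R ∩ S s).Nonempty → ∃ ν : E3, ‖ν‖ = 1 ∧
      ball (Z + (R - d) • ν) R ⊆ S s ∧ ball (Z - (R + d) • ν) R ⊆ S (!s) := by
    intro μ hμ hZμ hs
    have := h.tangent_ball_subset hΓ hR hN hX hμ hs
    refine ⟨μ, hμ.1, ?_, ?_⟩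
    · have e : Z + (R - d) • μ = X + R • μ := by rw [hZμ]; module
      rw [e]; exact this.1
    · have e : Z - (R + d) • μ = X - R • μ := by rw [hZμ]; module
      rw [e]; exact this.2
  rcases hd0.eq_or_lt with h0 | hpos
  · have hZX' : Z = X := dist_eq_zero.1 (hddef ▸ h0.symm)
    have hcen : X + R • ν ∈ ball (X + R • ν) R := mem_ball_self hR
    have hnot : X + R • ν ∉ Γ :=
      Set.disjoint_left.1 (hN.ball_disjoint hΓ hR.le hX hν) hcen
    rcases h.mem_or s hnot with hs | hs
    · exact hfin ν hν hZX ⟨_, hcen, hs⟩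
    · refine hfin (-ν) hν.neg (by rw [hZX', ← h0, zero_smul, add_zero]) ?_
      have := (h.tangent_ball_subset hΓ hR hN hX hν (s := !s) ⟨_, hcen, hs⟩).2
      rw [Bool.not_not, sub_eq_add_neg, ← smul_neg] at this
      exact ⟨_, mem_ball_self hR, this (mem_ball_self hR)⟩
  · have hZΓ : Z ∉ Γ := by
      intro hZΓ
      rw [infDist_zero_of_mem hZΓ] at hXd
      exact hpos.ne hXd
    have hZs : Z ∈ S s := (h.closure_subset s hZ).resolve_right hZΓ
    refine hfin ν hν hZX ⟨Z, ?_, hZs⟩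
    rw [mem_ball_iff_norm, hZX]
    have e : X + d • ν - (X + R • ν) = (d - R) • ν := by module
    rw [e, norm_smul, hν.1, mul_one, Real.norm_eq_abs, abs_of_neg (by linarith)]
    linarith

end Separates

/-! ### Large balls in the parts of a cuboid -/

/-- If balls of radius `R` that touch at `X`, with centres `X ± R μ`, and balls that touch at `Y`,
with centres `Y ± R ν`, are such that opposite balls do not meet, then the map from contact points
to normals is Lipschitz with constant `1 / R`. -/
lemma norm_sub_le_of_disjoint_balls {X Y μ ν : E3} {R : ℝ} (hR : 0 < R) (hμ : ‖μ‖ = 1)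
    (hν : ‖ν‖ = 1) (h₁ : Disjoint (ball (X + R • μ) R) (ball (Y - R • ν) R))
    (h₂ : Disjoint (ball (X - R • μ) R) (ball (Y + R • ν) R)) :
    R * ‖μ - ν‖ ≤ ‖X - Y‖ := by
  have hfar : ∀ A B : E3, Disjoint (ball A R) (ball B R) → (2 * R) ^ 2 ≤ ‖A - B‖ ^ 2 := by
    intro A B hAB
    have := (disjoint_ball_ball_iff hR hR).1 hAB
    rw [dist_eq_norm] at this
    gcongr
    linarith
  have k₁ := hfar _ _ h₁
  have k₂ := hfar _ _ h₂
  have e₁ : X + R • μ - (Y - R • ν) = (X - Y) + R • (μ + ν) := by module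
  have e₂ : X - R • μ - (Y + R • ν) = (X - Y) - R • (μ + ν) := by module
  rw [e₁] at k₁
  rw [e₂] at k₂
  have p₁ := parallelogram_law_with_norm ℝ (X - Y) (R • (μ + ν))
  have p₂ := parallelogram_law_with_norm ℝ μ ν
  rw [hμ, hν] at p₂
  rw [norm_smul, Real.norm_of_nonneg hR.le] at p₁
  refine le_of_sq_le_sq ?_ (norm_nonneg _)
  nlinarith

namespace Cuboid

/-- The midpoint of the projection of the cuboid on axis `i`. -/
noncomputable def mid (T : Cuboid) (i : Fin 3) : ℝ := (T.lo i + T.hi i) / 2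

lemma abs_sub_le_of_mem_carrier {T : Cuboid} {X Y : E3} (hX : X ∈ T.carrier)
    (hY : Y ∈ T.carrier) (i : Fin 3) : |X i - Y i| ≤ T.hi i - T.lo i := by
  have h1 := hX i
  have h2 := hY i
  rw [Set.mem_Icc] at h1 h2
  rw [abs_le]
  constructor <;> linarith [h1.1, h1.2, h2.1, h2.2]

end Cuboid

lemma norm_sq_eq_sum (v : E3) : ‖v‖ ^ 2 = v 0 ^ 2 + v 1 ^ 2 + v 2 ^ 2 := by
  rw [EuclideanSpace.norm_sq_eq]
  simp [Fin.sum_univ_three]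

lemma norm_le_of_abs_le {v : E3} {a : ℝ} (ha : 0 ≤ a) (h : ∀ i, |v i| ≤ a) : ‖v‖ ≤ √3 * a := by
  refine le_of_sq_le_sq ?_ (by positivity)
  rw [norm_sq_eq_sum, mul_pow, Real.sq_sqrt (by norm_num)]
  have := fun i => sq_le_sq.2 ((h i).trans (le_abs_self a))
  linarith [this 0, this 1, this 2]

lemma abs_apply_le_norm (v : E3) (i : Fin 3) : |v i| ≤ ‖v‖ := by
  simpa using PiLp.norm_apply_le v i

lemma exists_abs_apply_ge {v : E3} (hv : ‖v‖ = 1) : ∃ i, 57 / 100 ≤ |v i| := by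
  by_contra! hlt
  have h1 := norm_sq_eq_sum v
  have h2 : ∀ i, v i ^ 2 ≤ (57 / 100) ^ 2 := fun i => by
    rw [← sq_abs]
    have := (hlt i).le
    gcongr
  rw [hv] at h1
  linarith [h2 0, h2 1, h2 2]

/-- Moving from a point of a cuboid into the half of the cuboid that offers more room. -/
lemma Cuboid.ball_subset_interior {T : Cuboid} {Y Z : E3} (hY : Y ∈ T.carrier) {σ a : Fin 3 → ℝ}
    {r : ℝ} (hσ : ∀ k, σ k = 1 ∧ Y k ≤ T.mid k ∨ σ k = -1 ∧ T.mid k ≤ Y k)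
    (hZ : ∀ k, Z k = Y k + σ k * a k) (hra : ∀ k, r ≤ a k)
    (har : ∀ k, a k + r ≤ (T.hi k - T.lo k) / 2) :
    ∀ W ∈ ball Z r, ∀ k, W k ∈ Set.Ioo (T.lo k) (T.hi k) := by
  intro W hW k
  rw [mem_ball_iff_norm] at hW
  have h1 : |W k - Z k| < r := (abs_apply_le_norm (W - Z) k).trans_lt hW
  rw [abs_lt, hZ k] at h1
  have h2 := hY k
  rw [Set.mem_Icc] at h2
  have h3 := hra k
  have h4 := har k
  unfold Cuboid.mid at hσ
  rcases hσ k with ⟨h5, h6⟩ | ⟨h5, h6⟩ <;> rw [h5] at h1 <;> constructor <;> linarith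

/-- The part of a cuboid `T` on one side of the interface contains a ball of radius comparable to
the size of `T` unless it stays in one of the six half cuboids cut off by the planes
`x_i = mid i`.

Some component `i` of the unit normal at a point of `Γ ∩ T` is not small, and the normals vary
little over `T`. A point `Y` of side `s` in the half of `T` that offers room in the direction
of this component is either far from the surface, or close to a ball of radius `R` in side `s`
that touches the surface, and the direction of the axis `i` leads from `Y` into this ball. -/
lemma Separates.exists_ball_subset {Γ : Set E3} {S : Bool → Set E3} (h : Separates Γ S)
    (hΓ : IsClosedC2Surface Γ) {T : Cuboid} {H ρ : ℝ} (hH : 0 < H) (hρ : 1 ≤ ρ)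
    (hle : ∀ i, T.hi i - T.lo i ≤ H) (hge : ∀ i, H ≤ ρ * (T.hi i - T.lo i))
    (hN : HasDisjointNormals Γ (3 * √3 * H)) {s : Bool} (hmeet : (Γ ∩ T.carrier).Nonempty)
    (hlow : ∀ i, ∃ Y ∈ T.carrier, Y ∈ closure (S s) ∧ Y i ≤ T.mid i)
    (hhigh : ∀ i, ∃ Y ∈ T.carrier, Y ∈ closure (S s) ∧ T.mid i ≤ Y i) :
    ∃ Z, ball Z (H / (1600 * ρ)) ⊆ S s ∧
      ∀ W ∈ ball Z (H / (1600 * ρ)), ∀ i, W i ∈ Set.Ioo (T.lo i) (T.hi i) := by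
  set R : ℝ := 3 * √3 * H with hRdef
  have hs3 : (1.73 : ℝ) ≤ √3 := Real.le_sqrt_of_sq_le (by norm_num)
  have hRH : 5 * H ≤ R := by rw [hRdef]; nlinarith
  have hR : 0 < R := by linarith
  obtain ⟨X₀, hX₀Γ, hX₀T⟩ := hmeet
  have hne : Γ.Nonempty := ⟨X₀, hX₀Γ⟩
  obtain ⟨ν₀, hν₀, hb₀, hb₀'⟩ := h.exists_tangent_balls hΓ hR hN (s := s)
    (h.subset_closure s hX₀Γ) hne (by rw [infDist_zero_of_mem hX₀Γ]; exact hR)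
  rw [infDist_zero_of_mem hX₀Γ, sub_zero] at hb₀
  rw [infDist_zero_of_mem hX₀Γ, add_zero] at hb₀'
  obtain ⟨i, hi⟩ := exists_abs_apply_ge hν₀
  -- `τ` is the sign of the large component, and `Y` has room in this direction; on the other axes
  -- `σ` is chosen to offer room as well
  obtain ⟨Y, hYT, hYS, τ, hτ, hτν⟩ : ∃ Y ∈ T.carrier, Y ∈ closure (S s) ∧ ∃ τ : ℝ,
      (τ = 1 ∧ Y i ≤ T.mid i ∨ τ = -1 ∧ T.mid i ≤ Y i) ∧ τ * ν₀ i = |ν₀ i| := by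
    rcases le_total 0 (ν₀ i) with h0 | h0
    · obtain ⟨Y, hY, hYS, hYi⟩ := hlow i
      exact ⟨Y, hY, hYS, 1, Or.inl ⟨rfl, hYi⟩, by rw [abs_of_nonneg h0, one_mul]⟩
    · obtain ⟨Y, hY, hYS, hYi⟩ := hhigh i
      exact ⟨Y, hY, hYS, -1, Or.inr ⟨rfl, hYi⟩, by rw [abs_of_nonpos h0, neg_one_mul]⟩
  obtain ⟨σ, hσ, hσi⟩ : ∃ σ : Fin 3 → ℝ,
      (∀ k, σ k = 1 ∧ Y k ≤ T.mid k ∨ σ k = -1 ∧ T.mid k ≤ Y k) ∧ σ i = τ := by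
    refine ⟨fun k => if k = i then τ else if Y k ≤ T.mid k then 1 else -1, fun k => ?_, by simp⟩
    rcases eq_or_ne k i with rfl | hk
    · simpa using hτ
    · rcases le_total (Y k) (T.mid k) with h1 | h1
      · simp [hk, h1]
      · rcases h1.eq_or_lt with h2 | h2
        · simp [hk, h2]
        · simp [hk, not_le.2 h2, h1]
  have hσ1 : ∀ k, |σ k| = 1 := fun k => by rcases hσ k with h1 | h1 <;> simp [h1.1]
  have hρ0 : 0 < ρ := by linarith
  set t : ℝ := H / (20 * ρ) with ht
  have ht0 : 0 < t := by positivity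
  have hr : H / (1600 * ρ) = t / 80 := by rw [ht]; field_simp; norm_num
  have htlen : ∀ k, 20 * t ≤ T.hi k - T.lo k := fun k => by
    have : 20 * t = H / ρ := by rw [ht]; field_simp
    rw [this, div_le_iff₀ hρ0, mul_comm]
    exact hge k
  have htH : 20 * t ≤ H := (htlen 0).trans (hle 0)
  rw [hr]
  rcases le_or_gt (H / 10) (infDist Y Γ) with hfar | hnear
  · -- `Y` is far from the surface
    have hYΓ : Y ∉ Γ := fun hmem => by
      rw [infDist_zero_of_mem hmem] at hfar
      linarith
    have hYs : Y ∈ S s := (h.closure_subset s hYS).resolve_right hYΓ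
    have hball : ball Y (H / 10) ⊆ S s := by
      refine h.subset_of_isPreconnected (convex_ball _ _).isPreconnected ?_
        ⟨Y, mem_ball_self (by linarith), hYs⟩
      refine Set.disjoint_left.2 fun W hW hWΓ => ?_
      have := infDist_le_dist_of_mem (x := Y) hWΓ
      rw [mem_ball, dist_comm] at hW
      linarith
    refine ⟨Y + WithLp.toLp 2 fun k => σ k * (t / 40), ?_, ?_⟩
    · refine (ball_subset_ball' ?_).trans hball
      rw [dist_eq_norm, add_sub_cancel_left]
      have := norm_le_of_abs_le (v := WithLp.toLp 2 fun k => σ k * (t / 40)) (a := t / 40)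
        (by positivity) fun k => by
          simp only [abs_mul, hσ1, one_mul]
          rw [abs_of_pos (by positivity)]
      have h2 : √3 ≤ 2 := by rw [Real.sqrt_le_left (by norm_num)]; norm_num
      nlinarith
    · refine Cuboid.ball_subset_interior hYT (a := fun _ => t / 40) hσ (fun k => ?_)
        (fun k => by linarith) fun k => by linarith [htlen k]
      simp
  · -- `Y` is close to the surface
    obtain ⟨ν, hν, hb, hb'⟩ := h.exists_tangent_balls hΓ hR hN hYS hne (by linarith)
    set d := infDist Y Γ with hd
    have hd0 : 0 ≤ d := infDist_nonneg
    have hνν : R * ‖ν₀ - ν‖ ≤ ‖X₀ - (Y - d • ν)‖ := by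
      refine norm_sub_le_of_disjoint_balls hR hν₀ hν ?_ ?_
      · have e : Y - d • ν - R • ν = Y - (R + d) • ν := by module
        rw [e]
        exact (h.disjoint_not s).mono hb₀ hb'
      · have e : Y - d • ν + R • ν = Y + (R - d) • ν := by module
        rw [e]
        exact (h.disjoint_not s).symm.mono hb₀' hb
    have hclose : ‖ν₀ - ν‖ ≤ 9 / 25 := by
      have h1 : ‖X₀ - Y‖ ≤ √3 * H := norm_le_of_abs_le hH.le fun k =>
        (Cuboid.abs_sub_le_of_mem_carrier hX₀T hYT k).trans (hle k)
      have h2 : ‖X₀ - (Y - d • ν)‖ ≤ ‖X₀ - Y‖ + d := by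
        have e : X₀ - (Y - d • ν) = (X₀ - Y) + d • ν := by module
        rw [e]
        refine (norm_add_le _ _).trans ?_
        rw [norm_smul, hν, mul_one, Real.norm_of_nonneg hd0]
      have h3 : R * ‖ν₀ - ν‖ ≤ R * (9 / 25) := by
        have : √3 * H + H / 10 ≤ R * (9 / 25) := by rw [hRdef]; nlinarith
        linarith
      exact le_of_mul_le_mul_left h3 hR
    have hνi : 1 / 10 ≤ σ i * ν i := by
      have h1 := (abs_apply_le_norm (ν₀ - ν) i).trans hclose
      have h2 : |σ i * (ν₀ i - ν i)| ≤ 9 / 25 := by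
        rw [abs_mul, hσ1, one_mul]
        exact h1
      have h3 := le_abs_self (σ i * (ν₀ i - ν i))
      rw [mul_sub, hσi, hτν] at h3
      rw [hσi] at h2 ⊢
      rw [mul_sub, hτν] at h2
      linarith
    have hνk : ∀ k, -1 ≤ σ k * ν k := fun k => by
      have h1 := abs_apply_le_norm ν k
      rw [hν] at h1
      have h2 := neg_abs_le (σ k * ν k)
      rw [abs_mul, hσ1, one_mul] at h2
      linarith
    have hσsq : ∀ k, σ k ^ 2 = 1 := fun k => by rw [← sq_abs, hσ1, one_pow]
    -- the step to the centre is almost parallel to the axis `i`, with enough room on the others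
    set a : Fin 3 → ℝ := fun k => if k = i then t else t / 40 with ha
    set w : E3 := WithLp.toLp 2 fun k => σ k * a k with hw
    have ha1 : ∀ k, t / 40 ≤ a k := fun k => by simp only [ha]; split_ifs <;> linarith
    have ha2 : ∀ k, a k ≤ t := fun k => by simp only [ha]; split_ifs <;> linarith
    have hwsq : ‖w‖ ^ 2 ≤ 2 * t ^ 2 := by
      rw [norm_sq_eq_sum]
      simp only [hw, mul_pow, hσsq, one_mul]
      have hsum : a 0 ^ 2 + a 1 ^ 2 + a 2 ^ 2 = t ^ 2 + 2 * (t / 40) ^ 2 := by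
        fin_cases i <;> simp [ha] <;> ring
      rw [hsum]
      nlinarith
    have hwν : t / 20 ≤ ⟪w, ν⟫_ℝ := by
      have hin : ⟪w, ν⟫_ℝ = a 0 * (σ 0 * ν 0) + a 1 * (σ 1 * ν 1) + a 2 * (σ 2 * ν 2) := by
        simp [hw, PiLp.inner_apply, Fin.sum_univ_three]
        ring
      rw [hin]
      fin_cases i <;> simp [ha] <;> simp at hνi <;> nlinarith [hνk 0, hνk 1, hνk 2]
    refine ⟨Y + w, (ball_subset_ball' ?_).trans hb, ?_⟩
    · rw [dist_eq_norm]
      have e : Y + w - (Y + (R - d) • ν) = w - (R - d) • ν := by module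
      rw [e]
      have hsq : ‖w - (R - d) • ν‖ ^ 2 ≤ (R - t / 80) ^ 2 := by
        rw [norm_sub_sq_real, inner_smul_right, norm_smul, hν, mul_one, Real.norm_eq_abs, sq_abs]
        have hRd : R / 2 ≤ R - d := by linarith
        have hRd0 : 0 ≤ R - d := by linarith
        have h1 : R / 2 * (t / 20) ≤ (R - d) * ⟪w, ν⟫_ℝ := mul_le_mul hRd hwν (by positivity) hRd0
        have h2 : 80 * t * t ≤ R * t := by
          gcongr
          linarith
        have h3 : (R - d) ^ 2 ≤ R ^ 2 := pow_le_pow_left₀ hRd0 (by linarith) 2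
        have h4 : R ^ 2 - R * t / 40 ≤ (R - t / 80) ^ 2 := by
          have e4 : (R - t / 80) ^ 2 = R ^ 2 - R * t / 40 + (t / 80) ^ 2 := by ring
          rw [e4]
          linarith [sq_nonneg (t / 80)]
        linarith
      have := le_of_sq_le_sq hsq (by linarith)
      linarith
    · exact Cuboid.ball_subset_interior hYT (a := a) hσ (fun k => by simp [hw])
        (fun k => by linarith [ha1 k]) fun k => by linarith [htlen k, ha2 k]

/-! ### Extension of the two sides to the whole space -/

/-- The coordinatewise projection on the box with corners `a` and `b`. -/
noncomputable def clamp (a b : Fin 3 → ℝ) (X : E3) : E3 :=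
  WithLp.toLp 2 fun i => max (a i) (min (b i) (X i))

lemma continuous_clamp (a b : Fin 3 → ℝ) : Continuous (clamp a b) := by
  unfold clamp
  fun_prop

lemma clamp_eq_self {a b : Fin 3 → ℝ} {X : E3} (h : ∀ i, a i ≤ X i ∧ X i ≤ b i) :
    clamp a b X = X := by
  ext i
  simp [clamp, h i]

lemma eq_of_clamp_mem_Ioo {a b : Fin 3 → ℝ} {X : E3}
    (h : ∀ i, a i < clamp a b X i ∧ clamp a b X i < b i) : clamp a b X = X := by
  ext i
  have h1 := (h i).1
  have h2 := (h i).2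
  simp only [clamp] at h1 h2 ⊢
  grind

/-- The points of the segment from a point to its projection have the same projection. -/
lemma clamp_eq_of_mem_segment {a b : Fin 3 → ℝ} {X W : E3} (hab : ∀ i, a i ≤ b i)
    (hW : W ∈ segment ℝ X (clamp a b X)) : clamp a b W = clamp a b X := by
  obtain ⟨t, ht, rfl⟩ := (segment_eq_image_lineMap ℝ X (clamp a b X)) ▸ hW
  ext i
  have hi := hab i
  simp only [clamp, AffineMap.lineMap_apply_module, PiLp.add_apply, PiLp.smul_apply, smul_eq_mul]
  obtain ⟨ht0, ht1⟩ := ht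
  rcases le_total (X i) (a i) with h1 | h1
  · have h2 : (1 - t) * X i + t * a i ≤ a i := by nlinarith
    rw [min_eq_right (h1.trans hi), max_eq_left h1, min_eq_right (h2.trans hi), max_eq_left h2]
  · rcases le_total (b i) (X i) with h2 | h2
    · have h3 : b i ≤ (1 - t) * X i + t * b i := by nlinarith
      rw [min_eq_left h2, max_eq_right hi, min_eq_left h3, max_eq_right hi]
    · have h3 : (1 - t) * X i + t * X i = X i := by ring
      rw [min_eq_right h2, max_eq_right h1, h3, min_eq_right h2, max_eq_right h1]

/-- An interface in an open box separates the whole space: each side is extended by its preimage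
under the projection on a closed box that is contained in the open one and has the interface in
its interior. -/
lemma IsInterface.exists_separates {lo hi : Fin 3 → ℝ} {Ω Γ : Set E3} {side : Bool → Set E3}
    (hΩ : Ω = {X : E3 | ∀ i, X i ∈ Set.Ioo (lo i) (hi i)}) (h : IsInterface Ω Γ side)
    (hne : Γ.Nonempty) :
    ∃ S, Separates Γ S ∧ (∀ s, side s ⊆ S s) ∧ ∀ s, S s ∩ Ω ⊆ side s := by
  have hcpt : IsCompact Γ := h.surface.1
  have hΓΩ : ∀ X ∈ Γ, ∀ i, lo i < X i ∧ X i < hi i := fun X hX i => (hΩ ▸ h.subset hX) i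
  have hcoord : ∀ i, ContinuousOn (fun X : E3 => X i) Γ := fun i => by fun_prop
  have ha : ∀ i, ∃ a, lo i < a ∧ ∀ X ∈ Γ, a < X i := fun i => by
    obtain ⟨X, hX, hmin⟩ := hcpt.exists_isMinOn hne (hcoord i)
    obtain ⟨a, h1, h2⟩ := exists_between (hΓΩ X hX i).1
    exact ⟨a, h1, fun Y hY => h2.trans_le (hmin hY)⟩
  have hb : ∀ i, ∃ b, b < hi i ∧ ∀ X ∈ Γ, X i < b := fun i => by
    obtain ⟨X, hX, hmax⟩ := hcpt.exists_isMaxOn hne (hcoord i)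
    obtain ⟨b, h1, h2⟩ := exists_between (hΓΩ X hX i).2
    exact ⟨b, h2, fun Y hY => (hmax hY).trans_lt h1⟩
  choose a hlo haΓ using ha
  choose b hhi hbΓ using hb
  obtain ⟨X₀, hX₀⟩ := hne
  have hab : ∀ i, a i < b i := fun i => (haΓ i X₀ hX₀).trans (hbΓ i X₀ hX₀)
  have hmemΩ : ∀ X, clamp a b X ∈ Ω := fun X => by
    rw [hΩ]
    intro i
    have h1 := hlo i
    have h2 := hhi i
    have h3 := hab i
    simp only [clamp, Set.mem_Ioo]
    grind
  have hiff : ∀ X, clamp a b X ∈ Γ ↔ X ∈ Γ := fun X => by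
    constructor
    · intro hX
      rwa [eq_of_clamp_mem_Ioo fun i => ⟨haΓ i _ hX, hbΓ i _ hX⟩] at hX
    · intro hX
      rwa [clamp_eq_self fun i => ⟨(haΓ i _ hX).le, (hbΓ i _ hX).le⟩]
  have hdisj : ∀ s, Disjoint (side s) (side (!s)) := fun s => by
    cases s
    · exact h.disjoint
    · exact h.disjoint.symm
  have hor : ∀ s, ∀ X ∈ Ω, X ∉ Γ → X ∈ side s ∨ X ∈ side (!s) := fun s X hX hXΓ => by
    have : X ∈ side false ∪ side true := by rw [h.union]; exact ⟨hX, hXΓ⟩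
    cases s
    · exact this
    · exact this.symm
  have hsideΩ : ∀ s, side s ⊆ Ω \ Γ := fun s => by
    rw [← h.union]
    cases s
    · exact Set.subset_union_left
    · exact Set.subset_union_right
  have hconv : Convex ℝ Ω := by
    rw [hΩ]
    intro X hX Y hY s t hs ht hst i
    exact (convex_Ioo (lo i) (hi i)) (hX i) (hY i) hs ht hst
  have hsub : ∀ s, side s ⊆ clamp a b ⁻¹' side s := fun s X hX => by
    have hXΩ := hsideΩ s hX
    have hseg : segment ℝ X (clamp a b X) ⊆ side s := by
      refine (convex_segment _ _).isPreconnected.subset_left_of_subset_union (h.isOpen s)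
        (h.isOpen (!s)) (hdisj s) (fun W hW => ?_) ⟨X, left_mem_segment ℝ _ _, hX⟩
      refine hor s W (hconv.segment_subset hXΩ.1 (hmemΩ X) hW) fun hWΓ => hXΩ.2 ?_
      rwa [← hiff, ← clamp_eq_of_mem_segment (fun i => (hab i).le) hW, hiff]
    exact hseg (right_mem_segment ℝ _ _)
  refine ⟨fun s => clamp a b ⁻¹' side s, ⟨?_, ?_, ?_, ?_⟩, hsub, ?_⟩
  · exact fun s => (h.isOpen s).preimage (continuous_clamp a b)
  · exact h.disjoint.preimage _
  · rw [← Set.preimage_union, h.union]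
    ext X
    simp [hmemΩ X, hiff X]
  · exact fun s => (h.subset_closure s).trans (closure_mono (hsub s))
  · rintro s X ⟨hXs, hXΩ⟩
    have hXΓ : X ∉ Γ := fun hX => (hsideΩ s hXs).2 ((hiff X).2 hX)
    refine (hor s X hXΩ hXΓ).resolve_right fun hX' => ?_
    exact Set.disjoint_left.1 (hdisj s) hXs (hsub (!s) hX')

/-! ### Trilinear polynomials -/

/-- The unit vector of axis `i`. -/
noncomputable abbrev axis (i : Fin 3) : E3 := EuclideanSpace.single i 1

lemma expo_apply (S : Finset (Fin 3)) (i : Fin 3) : expo S i = if i ∈ S then 1 else 0 := by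
  simp [expo, Finsupp.finsetSum_apply, Finsupp.single_apply]

lemma expo_injective : Function.Injective expo := by
  intro S T h
  ext i
  have := DFunLike.congr_fun h i
  rw [expo_apply, expo_apply] at this
  by_cases h1 : i ∈ S <;> by_cases h2 : i ∈ T <;> simp_all

lemma sum_finset_fin_three {M : Type*} [AddCommMonoid M] (g : Finset (Fin 3) → M) :
    ∑ S, g S = g ∅ + (g {0} + (g {1} + (g {2} + (g {0, 1} + (g {0, 2} + (g {1, 2} +
      g {0, 1, 2})))))) := by
  have huniv : (Finset.univ : Finset (Finset (Fin 3))) =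
    {∅, {0}, {1}, {2}, {0, 1}, {0, 2}, {1, 2}, {0, 1, 2}} := by decide
  rw [huniv]
  repeat rw [Finset.sum_insert (by decide)]
  rw [Finset.sum_singleton]

lemma eq_expo_of_le_one {d : Fin 3 →₀ ℕ} (h : ∀ i, d i ≤ 1) : d = expo {i | d i = 1} := by
  ext i
  rw [expo_apply]
  have := h i
  simp only [Finset.mem_filter, Finset.mem_univ, true_and]
  split_ifs <;> omega

/-- The expansion of a trilinear polynomial in monomials. -/
lemma eq_sum_of_mem_Q1 {p : MvPolynomial (Fin 3) ℝ} (hp : p ∈ Q1) :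
    p = ∑ S, MvPolynomial.C (MvPolynomial.coeff (expo S) p) * ∏ i ∈ S, MvPolynomial.X i := by
  have hmon : ∀ (S : Finset (Fin 3)) (a : ℝ), MvPolynomial.C a * ∏ i ∈ S, MvPolynomial.X i =
      MvPolynomial.monomial (expo S) a := fun S a =>
    (MvPolynomial.monomial_sum_index S (fun i => Finsupp.single i 1) a).symm
  have hsub : p.support ⊆ Finset.univ.image expo := fun d hd =>
    Finset.mem_image.2 ⟨_, Finset.mem_univ _,
      (eq_expo_of_le_one ((MvPolynomial.mem_restrictDegree _ _ _).1 hp d hd)).symm⟩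
  conv_lhs => rw [p.as_sum]
  rw [Finset.sum_subset hsub fun d _ hd => by
      rw [MvPolynomial.notMem_support_iff.1 hd, MvPolynomial.monomial_zero],
    Finset.sum_image expo_injective.injOn]
  exact Finset.sum_congr rfl fun S _ => (hmon S _).symm

lemma val_eq {p : MvPolynomial (Fin 3) ℝ} (hp : p ∈ Q1) (X : E3) :
    val p X = ∑ S, MvPolynomial.coeff (expo S) p * ∏ i ∈ S, X i := by
  rw [val]
  conv_lhs => rw [eq_sum_of_mem_Q1 hp]
  simp

/-- A trilinear polynomial is affine in each variable, so that its partial derivatives are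
differences of its values. -/
lemma grad_apply {p : MvPolynomial (Fin 3) ℝ} (hp : p ∈ Q1) (X : E3) (i : Fin 3) :
    grad p X i = val p (X + axis i) - val p X := by
  have h : grad p X i = MvPolynomial.eval (fun j => X j) (MvPolynomial.pderiv i p) := rfl
  rw [h, val_eq hp, val_eq hp]
  conv_lhs => rw [eq_sum_of_mem_Q1 hp]
  simp only [sum_finset_fin_three]
  fin_cases i <;>
  · simp [Finset.prod_insert, MvPolynomial.pderiv_X]
    ring

lemma val_add (p q : MvPolynomial (Fin 3) ℝ) (X : E3) : val (p + q) X = val p X + val q X :=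
  map_add _ _ _

lemma val_sub (p q : MvPolynomial (Fin 3) ℝ) (X : E3) : val (p - q) X = val p X - val q X :=
  map_sub _ _ _

lemma val_smul (a : ℝ) (p : MvPolynomial (Fin 3) ℝ) (X : E3) : val (a • p) X = a * val p X := by
  simp [val]

lemma grad_add (p q : MvPolynomial (Fin 3) ℝ) (X : E3) : grad (p + q) X = grad p X + grad q X := by
  ext i
  simp [grad, val]

lemma grad_smul (a : ℝ) (p : MvPolynomial (Fin 3) ℝ) (X : E3) : grad (a • p) X = a • grad p X := by
  ext i
  simp [grad, val]

lemma continuous_val (p : MvPolynomial (Fin 3) ℝ) : Continuous (val p) := by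
  have h : Continuous fun X : E3 => (fun i => X i) := by fun_prop
  exact (MvPolynomial.continuous_eval p).comp h

lemma continuous_grad (p : MvPolynomial (Fin 3) ℝ) : Continuous (grad p) := by
  have := fun i => continuous_val (MvPolynomial.pderiv i p)
  unfold grad
  fun_prop

/-! ### Functions that are affine in each variable -/

/-- A continuous function that is affine in each variable. -/
structure IsMultiaffine (f : E3 → ℝ) : Prop where
  continuous : Continuous f
  affine : ∀ X i t, f (X + t • axis i) = f X + t * (f (X + axis i) - f X)

lemma isMultiaffine_val {p : MvPolynomial (Fin 3) ℝ} (hp : p ∈ Q1) : IsMultiaffine (val p) := by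
  refine ⟨continuous_val p, fun X i t => ?_⟩
  rw [val_eq hp, val_eq hp, val_eq hp]
  simp only [sum_finset_fin_three]
  fin_cases i <;>
  · simp [Finset.prod_insert]
    ring

lemma IsMultiaffine.difference {f : E3 → ℝ} (hf : IsMultiaffine f) (v : E3) :
    IsMultiaffine fun X => f (X + v) - f X := by
  refine ⟨by have := hf.continuous; fun_prop, fun X i t => ?_⟩
  have h1 := hf.affine (X + v) i t
  have h2 := hf.affine X i t
  have e : ∀ u : E3, X + u + v = X + v + u := fun u => by abel
  simp only [e, h1, h2]
  ring

lemma IsMultiaffine.sq_le {f : E3 → ℝ} (hf : IsMultiaffine f) {w M s : ℝ} (hw : 0 < w)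
    (hs : |s| ≤ M * w) (Y : E3) (i : Fin 3) :
    f (Y + s • axis i) ^ 2 ≤
      2 * (1 + M) ^ 2 * ∑ b : Bool, f (Y + (if b then w else 0) • axis i) ^ 2 := by
  have h1 := hf.affine Y i s
  have h2 := hf.affine Y i w
  -- linear interpolation between `Y` and `Y + w e_i`
  have h3 : f (Y + s • axis i) = (1 - s / w) * f Y + s / w * f (Y + w • axis i) := by
    rw [h1, h2]
    field_simp
    ring
  have hsw : |s / w| ≤ M := by
    rw [abs_div, abs_of_pos hw, div_le_iff₀ hw]
    exact hs
  have hM : 0 ≤ M := (abs_nonneg _).trans hsw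
  have h4 : (1 - s / w) ^ 2 ≤ (1 + M) ^ 2 := by
    rw [sq_le_sq, abs_of_nonneg (by linarith : 0 ≤ 1 + M)]
    exact (abs_sub _ _).trans (by rw [abs_one]; linarith)
  have h5 : (s / w) ^ 2 ≤ (1 + M) ^ 2 := by
    rw [sq_le_sq, abs_of_nonneg (by linarith : 0 ≤ 1 + M)]
    linarith
  have h6 : ((1 - s / w) * f Y) ^ 2 ≤ (1 + M) ^ 2 * f Y ^ 2 := by
    rw [mul_pow]; gcongr
  have h7 : (s / w * f (Y + w • axis i)) ^ 2 ≤ (1 + M) ^ 2 * f (Y + w • axis i) ^ 2 := by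
    rw [mul_pow]; gcongr
  have h8 := add_sq_le (a := (1 - s / w) * f Y) (b := s / w * f (Y + w • axis i))
  rw [h3]
  simp only [Fintype.sum_bool, if_true, Bool.false_eq_true, if_false, zero_smul, add_zero]
  linarith

/-- The vertices of the cube with lowest corner `0` and edge length `w`. -/
noncomputable def node (w : ℝ) (b : Bool × Bool × Bool) : E3 :=
  (if b.1 then w else 0) • axis 0 + (if b.2.1 then w else 0) • axis 1 +
    (if b.2.2 then w else 0) • axis 2

lemma eq_add_axis (F W : E3) : F =
    W + (F - W) 0 • axis 0 + (F - W) 1 • axis 1 + (F - W) 2 • axis 2 := by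
  ext i
  fin_cases i <;> simp

/-- Trilinear interpolation at the vertices of a cube bounds the value at a point that is not far
from the cube. -/
lemma IsMultiaffine.sq_le_sum_node {f : E3 → ℝ} (hf : IsMultiaffine f) {w M : ℝ} (hw : 0 < w)
    (hM : 0 ≤ M) {F W : E3} (hFW : ‖F - W‖ ≤ M * w) :
    f F ^ 2 ≤ (2 * (1 + M) ^ 2) ^ 3 * ∑ b, f (W + node w b) ^ 2 := by
  set Q : ℝ := 2 * (1 + M) ^ 2 with hQ
  have hQ0 : 0 ≤ Q := by positivity
  have hs : ∀ i, |(F - W) i| ≤ M * w := fun i => (abs_apply_le_norm _ _).trans hFW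
  have h1 : ∀ V : E3, f (W + V + (F - W) 0 • axis 0) ^ 2 ≤
      Q * ∑ b : Bool, f (W + V + (if b then w else 0) • axis 0) ^ 2 := fun V =>
    hf.sq_le hw (hs 0) _ _
  have h2 : ∀ V : E3, f (W + V + (F - W) 1 • axis 1) ^ 2 ≤
      Q * ∑ b : Bool, f (W + V + (if b then w else 0) • axis 1) ^ 2 := fun V =>
    hf.sq_le hw (hs 1) _ _
  have h3 := hf.sq_le hw (hs 2) (W + (F - W) 0 • axis 0 + (F - W) 1 • axis 1) 2
  rw [← eq_add_axis F W] at h3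
  calc f F ^ 2 ≤ Q * ∑ c : Bool, f (W + (F - W) 0 • axis 0 + (F - W) 1 • axis 1 +
        (if c then w else 0) • axis 2) ^ 2 := h3
    _ ≤ Q * ∑ c : Bool, Q * ∑ b : Bool, Q * ∑ a : Bool,
        f (W + node w (a, b, c)) ^ 2 := by
      gcongr with c _
      have e : W + (F - W) 0 • axis 0 + (F - W) 1 • axis 1 + (if c then w else 0) • axis 2 =
          W + ((F - W) 0 • axis 0 + (if c then w else 0) • axis 2) + (F - W) 1 • axis 1 := by
        abel
      rw [e]
      refine (h2 _).trans ?_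
      gcongr with b _
      have e : W + ((F - W) 0 • axis 0 + (if c then w else 0) • axis 2) +
          (if b then w else 0) • axis 1 = W + ((if b then w else 0) • axis 1 +
          (if c then w else 0) • axis 2) + (F - W) 0 • axis 0 := by abel
      rw [e]
      refine (h1 _).trans (le_of_eq ?_)
      congr 1
      refine Finset.sum_congr rfl fun a _ => ?_
      congr 2
      simp only [node]
      abel
    _ = Q ^ 3 * ∑ b, f (W + node w b) ^ 2 := by
      simp only [Fintype.sum_prod_type, Fintype.sum_bool]
      ring

lemma norm_node_le {w : ℝ} (hw : 0 ≤ w) (b : Bool × Bool × Bool) : ‖node w b‖ ≤ 2 * w := by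
  have h : ‖node w b‖ ≤ √3 * w := norm_le_of_abs_le hw fun i => by
    obtain ⟨a, b, c⟩ := b
    fin_cases i <;> simp [node] <;> split_ifs <;> simp [abs_of_nonneg, hw]
  have h2 : √3 ≤ 2 := by rw [Real.sqrt_le_left (by norm_num)]; norm_num
  exact h.trans (by gcongr)

/-- The constant of the inverse inequality on a set of diameter comparable to `H` that contains a
ball of radius `c H`. -/
noncomputable def inverseConst (c : ℝ) : ℝ := (4 / c) ^ 3 * (8 * (2 * (1 + 20 / c) ^ 2) ^ 3)

lemma integrableOn_of_continuous {g : E3 → ℝ} (hg : Continuous g) {S : Set E3} {Z : E3} {r : ℝ}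
    (hS : S ⊆ closedBall Z r) : IntegrableOn g S :=
  (hg.continuousOn.integrableOn_compact (isCompact_closedBall Z r)).mono_set hS

/-- An inverse inequality: interpolation at the vertices of small cubes in a ball contained in `S`,
averaged over the positions of the cube, bounds the value at a point not far from `S` by the mean
square over `S`. -/
lemma IsMultiaffine.sq_mul_volume_le {f : E3 → ℝ} (hf : IsMultiaffine f) {S : Set E3} {Z F : E3}
    {c H : ℝ} (hc : 0 < c) (hc1 : c ≤ 1) (hH : 0 < H) (hSH : S ⊆ closedBall Z (2 * H))
    (hball : ball Z (c * H) ⊆ S) (hF : ‖F - Z‖ ≤ 4 * H) :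
    f F ^ 2 * volume.real S ≤ inverseConst c * ∫ X in S, f X ^ 2 := by
  set w : ℝ := c * H / 4 with hw
  have hw0 : 0 < w := by positivity
  set B : Set E3 := ball Z (c * H / 2) with hB
  set Q : ℝ := 2 * (1 + 20 / c) ^ 2 with hQ
  set J : ℝ := ∫ X in S, f X ^ 2 with hJ
  have hcont : Continuous fun X => f X ^ 2 := hf.continuous.pow 2
  have hBfin : volume B ≠ ⊤ := measure_ball_lt_top.ne
  have hint : ∀ v : E3, IntegrableOn (fun W => f (W + v) ^ 2) B := fun v =>
    integrableOn_of_continuous (hcont.comp (continuous_add_const v)) ball_subset_closedBall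
  have hpt : ∀ W ∈ B, f F ^ 2 ≤ Q ^ 3 * ∑ b, f (W + node w b) ^ 2 := by
    intro W hW
    refine hf.sq_le_sum_node hw0 (by positivity) ?_
    have h1 : ‖Z - W‖ < c * H / 2 := by
      rw [← dist_eq_norm, dist_comm]; exact hW
    have h2 : ‖F - W‖ ≤ ‖F - Z‖ + ‖Z - W‖ := norm_sub_le_norm_sub_add_norm_sub F Z W
    have h3 : 20 / c * w = 5 * H := by rw [hw]; field_simp; norm_num
    rw [h3]
    nlinarith
  have hshift : ∀ b, ∫ W in B, f (W + node w b) ^ 2 ≤ J := by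
    intro b
    have hmp := measurePreserving_add_right (volume : Measure E3) (node w b)
    have hemb : MeasurableEmbedding fun W : E3 => W + node w b := measurableEmbedding_addRight _
    rw [hJ, ← hmp.setIntegral_preimage_emb hemb (fun X => f X ^ 2) S]
    have hpre : (fun W : E3 => W + node w b) ⁻¹' S ⊆ closedBall (Z - node w b) (2 * H) := by
      intro W hW
      have := hSH hW
      rw [mem_closedBall_iff_norm] at this ⊢
      rwa [show W - (Z - node w b) = W + node w b - Z by abel]
    refine setIntegral_mono_set
      (integrableOn_of_continuous (hcont.comp (continuous_add_const _)) hpre)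
      (Filter.Eventually.of_forall fun W => sq_nonneg _) (LE.le.eventuallyLE ?_)
    intro W hW
    refine hball ?_
    rw [mem_ball_iff_norm]
    have h1 : ‖W - Z‖ < c * H / 2 := by rw [← dist_eq_norm]; exact hW
    have h2 := norm_node_le hw0.le b
    have h3 := norm_add_le (W - Z) (node w b)
    rw [show W + node w b - Z = W - Z + node w b by abel]
    linarith
  have havg : f F ^ 2 * volume.real B ≤ Q ^ 3 * (8 * J) := by
    calc f F ^ 2 * volume.real B = ∫ W in B, f F ^ 2 := by
          rw [setIntegral_const, smul_eq_mul, mul_comm]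
      _ ≤ ∫ W in B, Q ^ 3 * ∑ b, f (W + node w b) ^ 2 := by
          refine setIntegral_mono_on (integrableOn_const hBfin) ?_ measurableSet_ball hpt
          exact (integrable_finsetSum _ fun b _ => hint (node w b)).const_mul _
      _ = Q ^ 3 * ∑ b, ∫ W in B, f (W + node w b) ^ 2 := by
          rw [integral_const_mul, integral_finsetSum _ fun b _ => hint (node w b)]
      _ ≤ Q ^ 3 * ∑ b : Bool × Bool × Bool, J := by
          gcongr with b _
          exact hshift b
      _ = Q ^ 3 * (8 * J) := by simp
  have hvol : volume.real S ≤ (4 / c) ^ 3 * volume.real B := by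
    calc volume.real S ≤ volume.real (closedBall Z (2 * H)) :=
          measureReal_mono hSH measure_closedBall_lt_top.ne
      _ = (4 / c) ^ 3 * volume.real B := by
          rw [hB, ← Measure.addHaar_real_closedBall_eq_addHaar_real_ball,
            Measure.addHaar_real_closedBall _ _ (by positivity),
            Measure.addHaar_real_closedBall _ _ (by positivity)]
          simp only [finrank_euclideanSpace, Fintype.card_fin]
          rw [← mul_assoc, ← mul_pow]
          congr 2
          field_simp
          norm_num
  calc f F ^ 2 * volume.real S ≤ f F ^ 2 * ((4 / c) ^ 3 * volume.real B) := by gcongr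
    _ = (4 / c) ^ 3 * (f F ^ 2 * volume.real B) := by ring
    _ ≤ (4 / c) ^ 3 * (Q ^ 3 * (8 * J)) := by gcongr
    _ = inverseConst c * J := by rw [inverseConst]; ring

/-! ### The discrete extension operator -/

/-- The affine polynomial `X ↦ (X - F) · ν`. -/
noncomputable def planePoly (F ν : E3) : Q1 :=
  ⟨MvPolynomial.monomial (expo ∅) (-⟪F, ν⟫_ℝ) + ∑ i, MvPolynomial.monomial (expo {i}) (ν i), by
    have h : ∀ S a, MvPolynomial.monomial (expo S) a ∈ Q1 := fun S a => by
      rw [MvPolynomial.mem_restrictDegree]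
      intro d hd i
      rw [Finset.mem_singleton.1 (MvPolynomial.support_monomial_subset hd), expo_apply]
      split_ifs <;> norm_num
    exact add_mem (h _ _) (sum_mem fun i _ => h _ _)⟩

lemma coeff_planePoly (F ν : E3) {S : Finset (Fin 3)} (hS : 2 ≤ S.card) :
    MvPolynomial.coeff (expo S) (planePoly F ν : MvPolynomial (Fin 3) ℝ) = 0 := by
  have h : ∀ T : Finset (Fin 3), T.card ≤ 1 → expo T ≠ expo S := fun T hT hTS => by
    rw [expo_injective hTS] at hT
    omega
  simp only [planePoly, MvPolynomial.coeff_add, MvPolynomial.coeff_sum, MvPolynomial.coeff_monomial]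
  rw [if_neg (h ∅ (by simp)), zero_add]
  exact Finset.sum_eq_zero fun i _ => if_neg (h {i} (by simp))

lemma val_planePoly (F ν X : E3) : val (planePoly F ν) X = ⟪X - F, ν⟫_ℝ := by
  have h : ⟪X, ν⟫_ℝ = ∑ i, ν i * X i := by simp [PiLp.inner_apply]
  rw [inner_sub_left, h]
  simp [planePoly, val, expo, MvPolynomial.eval_monomial]
  ring

lemma grad_planePoly (F ν X : E3) : grad (planePoly F ν) X = ν := by
  ext i
  rw [grad_apply (planePoly F ν).2, val_planePoly, val_planePoly, ← inner_sub_left]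
  simp [PiLp.inner_apply]

/-- The normal derivative at `F`, as a linear form on the trilinear polynomials. -/
noncomputable def normalDeriv (F ν : E3) : Q1 →ₗ[ℝ] ℝ where
  toFun p := ⟪grad p F, ν⟫_ℝ
  map_add' p q := by rw [Submodule.coe_add, grad_add, inner_add_left]
  map_smul' a p := by
    rw [Submodule.coe_smul, grad_smul, inner_smul_left]
    rfl

/-- The map that multiplies the normal derivative at `F` by `a` and changes the polynomial by a
multiple of `(X - F) · ν` only. -/
noncomputable def scaleNormal (F ν : E3) (a : ℝ) : Q1 →ₗ[ℝ] Q1 :=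
  LinearMap.id + (a - 1) • (normalDeriv F ν).smulRight (planePoly F ν)

lemma scaleNormal_apply (F ν : E3) (a : ℝ) (p : Q1) :
    scaleNormal F ν a p = p + ((a - 1) * ⟪grad p F, ν⟫_ℝ) • planePoly F ν := by
  simp [scaleNormal, normalDeriv, mul_smul]

lemma scaleNormal_comp {F ν : E3} (hν : ‖ν‖ = 1) {a b : ℝ} (hab : a * b = 1) :
    scaleNormal F ν a ∘ₗ scaleNormal F ν b = LinearMap.id := by
  ext1 p
  rw [LinearMap.comp_apply, scaleNormal_apply F ν a, scaleNormal_apply F ν b, LinearMap.id_apply,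
    Submodule.coe_add, Submodule.coe_smul, grad_add, grad_smul, grad_planePoly, inner_add_left,
    inner_smul_left, real_inner_self_eq_norm_sq, hν, add_assoc, ← add_smul]
  have : (b - 1) * ⟪grad p F, ν⟫_ℝ + (a - 1) * (⟪grad p F, ν⟫_ℝ +
      (starRingEnd ℝ) ((b - 1) * ⟪grad p F, ν⟫_ℝ) * 1 ^ 2) = (a * b - 1) * ⟪grad p F, ν⟫_ℝ := by
    simp only [conj_trivial]
    ring
  rw [this, hab, sub_self, zero_mul, zero_smul, add_zero]

/-- `scaleNormal` for a nonzero factor, as a linear bijection. -/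
noncomputable def scaleNormalEquiv {F ν : E3} (hν : ‖ν‖ = 1) {a b : ℝ} (hab : a * b = 1) :
    Q1 ≃ₗ[ℝ] Q1 :=
  LinearEquiv.ofLinearMap (scaleNormal F ν a) (scaleNormal F ν b) (scaleNormal_comp hν hab)
    (scaleNormal_comp hν (by rw [mul_comm, hab]))

lemma triCentroid_mem_plane (P : Fin 3 → E3) : triCentroid P ∈ plane P := by
  have hP : ∀ j, P j ∈ plane P := fun j => mem_affineSpan ℝ ⟨j, rfl⟩
  have h : triCentroid P =
      AffineMap.lineMap (P 0) (AffineMap.lineMap (P 1) (P 2) (1 / 2 : ℝ)) (2 / 3 : ℝ) := by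
    simp only [AffineMap.lineMap_apply_module, triCentroid]
    module
  rw [h]
  exact AffineMap.lineMap_mem _ (hP 0) (AffineMap.lineMap_mem _ (hP 1) (hP 2))

lemma IsPlaneNormal.exists_eq_smul {P : Fin 3 → E3} {ν v : E3} (hP : AffineIndependent ℝ P)
    (hν : IsPlaneNormal P ν) (hv : ∀ u ∈ (plane P).direction, ⟪u, v⟫_ℝ = 0) :
    ∃ c : ℝ, v = c • ν := by
  have h2 : Module.finrank ℝ (plane P).direction = 2 := by
    rw [plane, direction_affineSpan]
    exact hP.finrank_vectorSpan (by simp)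
  have h1 : Module.finrank ℝ (plane P).directionᗮ = 1 := by
    have := Submodule.finrank_add_finrank_orthogonal (plane P).direction
    rw [h2, finrank_euclideanSpace, Fintype.card_fin] at this
    omega
  have hν0 : (⟨ν, (Submodule.mem_orthogonal _ _).2 hν.2⟩ : (plane P).directionᗮ) ≠ 0 := by
    intro h0
    have : ν = 0 := congrArg Subtype.val h0
    have h3 := hν.1
    rw [this, norm_zero] at h3
    exact zero_ne_one h3
  obtain ⟨c, hc⟩ := (finrank_eq_one_iff_of_nonzero' _ hν0).1 h1
    ⟨v, (Submodule.mem_orthogonal _ _).2 hv⟩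
  exact ⟨c, (congrArg Subtype.val hc).symm⟩

/-- A trilinear polynomial without the monomials `xy`, `xz`, `yz`, `xyz` that vanishes on the plane
is a multiple of `(X - F) · ν`. -/
lemma exists_eq_smul_planePoly {P : Fin 3 → E3} {ν : E3} (hP : AffineIndependent ℝ P)
    (hν : IsPlaneNormal P ν) {d : Q1}
    (hcoeff : ∀ S : Finset (Fin 3), 2 ≤ S.card →
      MvPolynomial.coeff (expo S) (d : MvPolynomial (Fin 3) ℝ) = 0)
    (hd : ∀ X ∈ plane P, val d X = 0) : ∃ c : ℝ, d = c • planePoly (triCentroid P) ν := by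
  set v : E3 := WithLp.toLp 2 fun i =>
    MvPolynomial.coeff (expo {i}) (d : MvPolynomial (Fin 3) ℝ) with hv
  set c₀ := MvPolynomial.coeff (expo ∅) (d : MvPolynomial (Fin 3) ℝ) with hc₀
  have hval : ∀ X : E3, val d X = c₀ + ⟪X, v⟫_ℝ := fun X => by
    rw [val_eq d.2, sum_finset_fin_three, hcoeff {0, 1} (by decide), hcoeff {0, 2} (by decide),
      hcoeff {1, 2} (by decide), hcoeff {0, 1, 2} (by decide)]
    simp [hv, hc₀, PiLp.inner_apply, Fin.sum_univ_three]
    ring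
  have hF := triCentroid_mem_plane P
  have hFval := hd _ hF
  rw [hval] at hFval
  obtain ⟨c, hc⟩ := hν.exists_eq_smul hP (v := v) fun u hu => by
    have h1 := hd _ (AffineSubspace.vadd_mem_of_mem_direction hu hF)
    rw [hval, vadd_eq_add, inner_add_left] at h1
    linarith
  refine ⟨c, Subtype.ext (MvPolynomial.funext fun x => ?_)⟩
  change val d (WithLp.toLp 2 x) =
    val (c • planePoly (triCentroid P) ν : MvPolynomial (Fin 3) ℝ) (WithLp.toLp 2 x)
  rw [val_smul, val_planePoly, hval, inner_sub_left, mul_sub]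
  rw [hc, inner_smul_right] at hFval ⊢
  linarith

/-- The approximate jump conditions determine the extension operator: it multiplies the normal
derivative at the centroid by `β⁻ / β⁺`. -/
lemma isExtensionOperator_scaleNormalEquiv {P : Fin 3 → E3} {ν : E3} (hP : AffineIndependent ℝ P)
    (hν : IsPlaneNormal P ν) {βm βp : ℝ} (hβp : βp ≠ 0)
    (hab : βm / βp * (βp / βm) = 1) :
    IsExtensionOperator βm βp P ν (scaleNormalEquiv (F := triCentroid P) hν.1 hab) := by
  intro p q
  set F := triCentroid P with hF
  have hC : scaleNormalEquiv (F := F) hν.1 hab p =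
      p + ((βm / βp - 1) * ⟪grad p F, ν⟫_ℝ) • planePoly F ν := scaleNormal_apply F ν _ p
  have hflux : ∀ c : ℝ, ⟪grad (p + c • planePoly F ν : MvPolynomial (Fin 3) ℝ) F, ν⟫_ℝ =
      ⟪grad p F, ν⟫_ℝ + c := fun c => by
    rw [grad_add, grad_smul, grad_planePoly, inner_add_left, inner_smul_left,
      real_inner_self_eq_norm_sq, hν.1]
    simp
  rw [hC]
  constructor
  · intro h
    obtain ⟨c, hc⟩ := exists_eq_smul_planePoly hP hν (d := q - p)
      (fun S hS => by rw [Submodule.coe_sub, MvPolynomial.coeff_sub, h.coeff S hS, sub_self])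
      fun X hX => by rw [Submodule.coe_sub, val_sub, h.trace X hX, sub_self]
    have hq : q = p + c • planePoly F ν := by rw [← hc, add_sub_cancel]
    have h1 := h.flux
    rw [hq, Submodule.coe_add, Submodule.coe_smul, hflux] at h1
    have h2 : c = (βm / βp - 1) * ⟪grad p F, ν⟫_ℝ := by
      field_simp
      linarith
    rw [hq, h2]
  · rintro rfl
    refine ⟨fun X hX => ?_, fun S hS => ?_, ?_⟩
    · have hXF : ⟪X - F, ν⟫_ℝ = 0 :=
        hν.2 _ (AffineSubspace.vsub_mem_direction hX (triCentroid_mem_plane P))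
      rw [Submodule.coe_add, Submodule.coe_smul, val_add, val_smul, val_planePoly, hXF, mul_zero,
        add_zero]
    · rw [Submodule.coe_add, Submodule.coe_smul, MvPolynomial.coeff_add, MvPolynomial.coeff_smul,
        coeff_planePoly F ν hS, smul_zero, add_zero]
    · rw [Submodule.coe_add, Submodule.coe_smul, hflux]
      field_simp
      ring

/-! ### Stability -/

lemma IsMultiaffine.sq_deriv_le {f : E3 → ℝ} (hf : IsMultiaffine f) {H : ℝ} (F : E3) (i : Fin 3) :
    H ^ 2 * (f (F + axis i) - f F) ^ 2 ≤ 2 * (f (F + H • axis i) ^ 2 + f F ^ 2) := by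
  have h := hf.affine F i H
  have e : H ^ 2 * (f (F + axis i) - f F) ^ 2 = (f (F + H • axis i) - f F) ^ 2 := by
    rw [h]; ring
  rw [e]
  nlinarith [sq_nonneg (f (F + H • axis i) + f F)]

/-- On a set that contains a ball of radius `c H` and has a diameter comparable to `H`, changing
a polynomial by a multiple of `(∇p(F) · ν) (X - F) · ν` is stable in both seminorms, by the
inverse inequality. -/
lemma sobolevSeminorm_scaleNormal_le {F ν Z : E3} (hν : ‖ν‖ = 1) {S : Set E3} {c H a B : ℝ}
    (hc : 0 < c) (hc1 : c ≤ 1) (hH : 0 < H) (hSH : S ⊆ closedBall Z (2 * H))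
    (hball : ball Z (c * H) ⊆ S) (hF : ‖F - Z‖ ≤ 2 * H) (hSm : MeasurableSet S)
    (hB : 1 ≤ B) (haB : |a - 1| ≤ B) (j : Fin 2) (p : Q1) :
    sobolevSeminorm j S (scaleNormal F ν a p) ≤
      √(2 + 384 * inverseConst c) * B * sobolevSeminorm j S p := by
  set I := inverseConst c with hI
  have hI0 : 0 ≤ I := by rw [hI, inverseConst]; positivity
  set k : ℝ := (a - 1) * ⟪grad p F, ν⟫_ℝ with hk
  have hB0 : 0 ≤ B := by linarith
  have hBsq : 1 ≤ B ^ 2 := one_le_pow₀ hB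
  have hkB : k ^ 2 ≤ B ^ 2 * ‖grad p F‖ ^ 2 := by
    rw [hk, mul_pow]
    have h1 : (a - 1) ^ 2 ≤ B ^ 2 := by rw [sq_le_sq, abs_of_nonneg hB0]; exact haB
    have h2 : ⟪grad p F, ν⟫_ℝ ^ 2 ≤ ‖grad p F‖ ^ 2 := by
      have := abs_real_inner_le_norm (grad p F) ν
      rw [hν, mul_one] at this
      rw [sq_le_sq, abs_of_nonneg (norm_nonneg _)]
      exact this
    gcongr
  have hq : ((scaleNormal F ν a p : Q1) : MvPolynomial (Fin 3) ℝ) = p + k • planePoly F ν := by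
    rw [scaleNormal_apply]; rfl
  have hp := isMultiaffine_val p.2
  have hV0 : 0 ≤ volume.real S := measureReal_nonneg
  have hSfin : volume S ≠ ⊤ := ((measure_mono hSH).trans_lt measure_closedBall_lt_top).ne
  have hint : ∀ {g : E3 → ℝ}, Continuous g → IntegrableOn g S := fun hg =>
    integrableOn_of_continuous hg hSH
  -- both seminorms reduce to an inequality between integrals
  have hsqrt : ∀ {A J : ℝ}, 0 ≤ J → A ≤ B ^ 2 * (2 + 384 * I) * J →
      √A ≤ √(2 + 384 * I) * B * √J := by
    intro A J hJ hA
    refine (Real.sqrt_le_sqrt hA).trans (le_of_eq ?_)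
    rw [Real.sqrt_mul (by positivity), Real.sqrt_mul (by positivity), Real.sqrt_sq hB0]
    ring
  have hcv := continuous_val (p : MvPolynomial (Fin 3) ℝ)
  have hcg := continuous_grad (p : MvPolynomial (Fin 3) ℝ)
  have hconst : ∀ t : ℝ, IntegrableOn (fun _ => t) S := fun t => integrableOn_const hSfin
  fin_cases j
  · set J := ∫ X in S, val p X ^ 2 with hJ
    have hJ0 : 0 ≤ J := integral_nonneg fun X => sq_nonneg _
    refine hsqrt hJ0 ?_
    have hbound : ∀ E : E3, ‖E - Z‖ ≤ 4 * H → val p E ^ 2 * volume.real S ≤ I * J := fun E hE =>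
      hp.sq_mul_volume_le hc hc1 hH hSH hball hE
    have hgrad : H ^ 2 * ‖grad p F‖ ^ 2 * volume.real S ≤ 12 * (I * J) := by
      have h1 := hbound F (by linarith)
      have h2 : ∀ i, H ^ 2 * grad p F i ^ 2 * volume.real S ≤ 4 * (I * J) := fun i => by
        have h3 := hbound (F + H • axis i) (by
          have h4 := norm_add_le (F - Z) (H • axis i)
          rw [norm_smul, PiLp.norm_single, norm_one, mul_one,
            Real.norm_of_nonneg hH.le] at h4
          rw [show F + H • axis i - Z = F - Z + H • axis i by abel]
          linarith)
        have h5 := hp.sq_deriv_le (H := H) F i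
        rw [grad_apply p.2]
        calc _ ≤ 2 * (val p (F + H • axis i) ^ 2 + val p F ^ 2) * volume.real S := by gcongr
          _ ≤ _ := by linarith
      rw [norm_sq_eq_sum]
      linarith [h2 0, h2 1, h2 2]
    calc ∫ X in S, val (scaleNormal F ν a p : Q1) X ^ 2
        ≤ ∫ X in S, (2 * val p X ^ 2 + 2 * (k ^ 2 * (16 * H ^ 2))) := by
          refine setIntegral_mono_on (hint ((continuous_val _).pow 2))
            (hint (by fun_prop)) hSm
            fun X hX => ?_
          rw [hq, val_add, val_smul, val_planePoly]
          have h1 : ⟪X - F, ν⟫_ℝ ^ 2 ≤ 16 * H ^ 2 := by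
            have h2 := abs_real_inner_le_norm (X - F) ν
            have h3 := norm_sub_le_norm_sub_add_norm_sub X Z F
            have h4 := mem_closedBall_iff_norm.1 (hSH hX)
            rw [norm_sub_rev Z F] at h3
            rw [hν, mul_one] at h2
            have h5 : |⟪X - F, ν⟫_ℝ| ≤ |4 * H| := by
              rw [abs_of_pos (by positivity : 0 < 4 * H)]; linarith
            have := sq_le_sq.2 h5
            linarith
          have h6 : k ^ 2 * ⟪X - F, ν⟫_ℝ ^ 2 ≤ k ^ 2 * (16 * H ^ 2) := by gcongr
          have h7 := add_sq_le (a := val p X) (b := k * ⟪X - F, ν⟫_ℝ)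
          rw [mul_pow] at h7
          linarith
      _ = 2 * J + 32 * (k ^ 2 * H ^ 2 * volume.real S) := by
          have hA : IntegrableOn (fun X => 2 * val p X ^ 2) S := hint (by fun_prop)
          rw [integral_add hA (hconst _), integral_const_mul, setIntegral_const, smul_eq_mul]
          ring
      _ ≤ 2 * J + 32 * (B ^ 2 * ‖grad p F‖ ^ 2 * H ^ 2 * volume.real S) := by gcongr
      _ = 2 * J + 32 * B ^ 2 * (H ^ 2 * ‖grad p F‖ ^ 2 * volume.real S) := by ring
      _ ≤ 2 * J + 32 * B ^ 2 * (12 * (I * J)) := by gcongr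
      _ ≤ B ^ 2 * (2 + 384 * I) * J := by nlinarith
  · set J := ∫ X in S, ‖grad p X‖ ^ 2 with hJ
    have hJ0 : 0 ≤ J := integral_nonneg fun X => sq_nonneg _
    refine hsqrt hJ0 ?_
    have hgrad : ‖grad p F‖ ^ 2 * volume.real S ≤ I * J := by
      have h1 : ∀ i, grad p F i ^ 2 * volume.real S ≤ I * ∫ X in S, grad p X i ^ 2 := fun i => by
        simp only [grad_apply p.2]
        exact (hp.difference (axis i)).sq_mul_volume_le hc hc1 hH hSH hball (by linarith)
      have h2 : ∀ i, IntegrableOn (fun X => grad p X i ^ 2) S := fun i =>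
        hint (((continuous_val (MvPolynomial.pderiv i p)).pow 2 :))
      have h01 : IntegrableOn (fun X => grad p X 0 ^ 2 + grad p X 1 ^ 2) S := (h2 0).add (h2 1)
      have h3 : J = (∫ X in S, grad p X 0 ^ 2) + (∫ X in S, grad p X 1 ^ 2) +
          ∫ X in S, grad p X 2 ^ 2 := by
        rw [← integral_add (h2 0) (h2 1), ← integral_add h01 (h2 2), hJ]
        simp only [norm_sq_eq_sum]
      rw [norm_sq_eq_sum, h3]
      linarith [h1 0, h1 1, h1 2]
    calc ∫ X in S, ‖grad (scaleNormal F ν a p : Q1) X‖ ^ 2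
        ≤ ∫ X in S, (2 * ‖grad p X‖ ^ 2 + 2 * k ^ 2) := by
          refine setIntegral_mono_on (hint ((continuous_grad _).norm.pow 2))
            (hint (by fun_prop)) hSm fun X hX => ?_
          rw [hq, grad_add, grad_smul, grad_planePoly]
          have h1 := norm_add_le (grad p X) (k • ν)
          rw [norm_smul, hν, mul_one, Real.norm_eq_abs] at h1
          have h2 := add_sq_le (a := ‖grad p X‖) (b := |k|)
          rw [sq_abs] at h2
          have h3 := pow_le_pow_left₀ (norm_nonneg _) h1 2
          linarith
      _ = 2 * J + 2 * (k ^ 2 * volume.real S) := by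
          have hA : IntegrableOn (fun X => 2 * ‖grad p X‖ ^ 2) S := hint (by fun_prop)
          rw [integral_add hA (hconst _), integral_const_mul, setIntegral_const, smul_eq_mul]
          ring
      _ ≤ 2 * J + 2 * (B ^ 2 * ‖grad p F‖ ^ 2 * volume.real S) := by gcongr
      _ = 2 * J + 2 * B ^ 2 * (‖grad p F‖ ^ 2 * volume.real S) := by ring
      _ ≤ 2 * J + 2 * B ^ 2 * (I * J) := by gcongr
      _ ≤ B ^ 2 * (2 + 384 * I) * J := by nlinarith [mul_nonneg (mul_nonneg hI0 hJ0) (sq_nonneg B)]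

/-! ### Configurations -/

namespace Cuboid

lemma convex_carrier (T : Cuboid) : Convex ℝ T.carrier := fun _ hX _ hY _ _ hs ht hst i =>
  (convex_Icc (T.lo i) (T.hi i)) (hX i) (hY i) hs ht hst

lemma isClosed_carrier (T : Cuboid) : IsClosed T.carrier := by
  have h : T.carrier = ⋂ i, {X : E3 | X i ∈ Set.Icc (T.lo i) (T.hi i)} := by
    ext X
    simp [carrier]
  rw [h]
  exact isClosed_iInter fun i => isClosed_Icc.preimage (by fun_prop)

lemma vertex_mem_carrier (T : Cuboid) (b : Fin 3 → Bool) : T.vertex b ∈ T.carrier := by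
  intro i
  have := (T.lo_lt_hi i).le
  simp only [vertex]
  split_ifs <;> simp [this]

lemma edge_subset_carrier (T : Cuboid) (d : Fin 3) (b : Fin 3 → Bool) :
    T.edge d b ⊆ T.carrier :=
  T.convex_carrier.segment_subset (T.vertex_mem_carrier _) (T.vertex_mem_carrier _)

lemma carrier_subset_closedBall {T : Cuboid} {H : ℝ} (hH : 0 ≤ H)
    (hle : ∀ i, T.hi i - T.lo i ≤ H) {Z : E3} (hZ : Z ∈ T.carrier) :
    T.carrier ⊆ closedBall Z (2 * H) := by
  intro X hX
  rw [mem_closedBall_iff_norm]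
  have h1 := norm_le_of_abs_le (v := X - Z) hH fun i =>
    (abs_sub_le_of_mem_carrier hX hZ i).trans (hle i)
  have h2 : √3 ≤ 2 := by rw [Real.sqrt_le_left (by norm_num)]; norm_num
  nlinarith

/-- The set `A` meets, within the cuboid, both closed halves into which the plane `x_i = mid i`
cuts the cuboid. -/
def MeetsHalves (T : Cuboid) (A : Set E3) (i : Fin 3) : Prop :=
  (∃ Y ∈ T.carrier, Y ∈ A ∧ Y i ≤ T.mid i) ∧ ∃ Y ∈ T.carrier, Y ∈ A ∧ T.mid i ≤ Y i

end Cuboid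

namespace Labelling

variable (g : Labelling) {T : Cuboid} {A : Set E3}

lemma vertex_mem_carrier (T : Cuboid) (b : Fin 3 → Bool) : g.vertex T b ∈ T.carrier :=
  T.vertex_mem_carrier _

/-- The segment between vertices on opposite faces `x_i = lo i` and `x_i = hi i`: if one of the
vertices and a point of the segment that is not nearer to it than to the other one are in `A`,
then `A` meets both halves. -/
lemma meetsHalves_of_mem_segment {b b' : Fin 3 → Bool} {i : Fin 3}
    (hb : b (g.perm i) ≠ b' (g.perm i)) {D : E3}
    (hD : D ∈ segment ℝ (g.vertex T b) (g.vertex T b'))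
    (hfar : 1 / 2 * dist (g.vertex T b) (g.vertex T b') ≤ dist (g.vertex T b) D)
    (hbA : g.vertex T b ∈ A) (hDA : D ∈ A) : T.MeetsHalves A i := by
  have hDT : D ∈ T.carrier := T.convex_carrier.segment_subset
    (g.vertex_mem_carrier T b) (g.vertex_mem_carrier T b') hD
  have hlt := T.lo_lt_hi i
  have hcoord : g.vertex T b i = T.hi i ∧ g.vertex T b' i = T.lo i ∨
      g.vertex T b i = T.lo i ∧ g.vertex T b' i = T.hi i := by
    have h : ∀ b, g.vertex T b i = if xor (g.flip i) (b (g.perm i)) then T.hi i else T.lo i :=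
      fun _ => rfl
    rw [h, h]
    cases h0 : g.flip i <;> cases h1 : b (g.perm i) <;> cases h2 : b' (g.perm i) <;> simp_all
  have hne : g.vertex T b ≠ g.vertex T b' := by
    intro he
    rw [he] at hcoord
    rcases hcoord with h | h <;> linarith [h.1, h.2]
  rw [segment_eq_image_lineMap] at hD
  obtain ⟨t, ht, rfl⟩ := hD
  have ht2 : 1 / 2 ≤ t := by
    rw [dist_left_lineMap, Real.norm_of_nonneg ht.1] at hfar
    exact le_of_mul_le_mul_right hfar (dist_pos.2 hne)
  have hDi : AffineMap.lineMap (g.vertex T b) (g.vertex T b') t i =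
      (1 - t) * g.vertex T b i + t * g.vertex T b' i := by
    simp [AffineMap.lineMap_apply_module]
  rcases hcoord with ⟨h1, h2⟩ | ⟨h1, h2⟩
  · refine ⟨⟨_, hDT, hDA, ?_⟩, ⟨_, g.vertex_mem_carrier T b, hbA, ?_⟩⟩
    · rw [hDi, h1, h2, Cuboid.mid]
      nlinarith
    · rw [h1, Cuboid.mid]
      linarith
  · refine ⟨⟨_, g.vertex_mem_carrier T b, hbA, ?_⟩, ⟨_, hDT, hDA, ?_⟩⟩
    · rw [h1, Cuboid.mid]
      linarith
    · rw [hDi, h1, h2, Cuboid.mid]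
      nlinarith

lemma meetsHalves_of_vertices {b b' : Fin 3 → Bool} {i : Fin 3}
    (hb : b (g.perm i) ≠ b' (g.perm i)) (hbA : g.vertex T b ∈ A) (hbA' : g.vertex T b' ∈ A) :
    T.MeetsHalves A i :=
  g.meetsHalves_of_mem_segment hb (right_mem_segment ℝ _ _)
    (by linarith [dist_nonneg (x := g.vertex T b) (y := g.vertex T b')]) hbA hbA'

end Labelling

/-- Except for the first axis in configuration `III`, there are vertices on the side of `A₈` on
both faces orthogonal to the axis. -/
lemma Config.exists_notMem_firstVertices (c : Config) (m : Fin 3) (h : c = .III → m ≠ 0) :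
    ∃ b b', b ∉ c.firstVertices ∧ b' ∉ c.firstVertices ∧ b m ≠ b' m := by
  cases c <;> simp only [Config.firstVertices, Set.mem_insert_iff, Set.mem_singleton_iff] <;>
    fin_cases m <;> first | exact absurd rfl (h rfl) | decide

/-- Except for the first axis in configuration `III`, there are vertices on the side of `A₁` on
both faces orthogonal to the axis, if the configuration is `III` or `V`. -/
lemma Config.exists_mem_firstVertices {c : Config} (hc : c = .V ∨ c = .III) (m : Fin 3)
    (h : c = .III → m ≠ 0) :
    ∃ b b', b ∈ c.firstVertices ∧ b' ∈ c.firstVertices ∧ b m ≠ b' m := by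
  rcases hc with rfl | rfl <;>
    simp only [Config.firstVertices, Set.mem_insert_iff, Set.mem_singleton_iff] <;>
    fin_cases m <;> first | exact absurd rfl (h rfl) | decide

lemma parallelEdges_spec {e : (Fin 3 → Bool) × (Fin 3 → Bool)} (he : e ∈ parallelEdges) :
    e.1 ∉ Config.III.firstVertices ∧ e.2 ∈ Config.III.firstVertices ∧ e.1 0 ≠ e.2 0 := by
  simp only [parallelEdges, Set.mem_insert_iff, Set.mem_singleton_iff] at he
  simp only [Config.firstVertices, Set.mem_insert_iff, Set.mem_singleton_iff]
  rcases he with rfl | rfl | rfl | rfl <;> decide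

section

variable {Ω Γ : Set E3} {side : Bool → Set E3} {T : Cuboid} {g : Labelling} {s : Bool} {c : Config}

lemma HasConfig.meetsHalves_last (h : HasConfig Γ side T g s c) (hΓ : IsInterface Ω Γ side)
    (hfar : c = .III → SomeCutFar Γ T g) (i : Fin 3) :
    T.MeetsHalves (closure (side (!s))) i := by
  by_cases hcase : c = .III ∧ g.perm i = 0
  · obtain ⟨rfl, hi⟩ := hcase
    obtain ⟨e, he, D, ⟨hDΓ, hD⟩, hdist⟩ := hfar rfl
    obtain ⟨h1, -, h3⟩ := parallelEdges_spec he
    exact g.meetsHalves_of_mem_segment (by rwa [hi]) hD hdist ((h e.1).2 h1).1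
      (hΓ.subset_closure _ hDΓ)
  · obtain ⟨b, b', hb, hb', hne⟩ := c.exists_notMem_firstVertices (g.perm i)
      fun h1 h2 => hcase ⟨h1, h2⟩
    exact g.meetsHalves_of_vertices hne ((h b).2 hb).1 ((h b').2 hb').1

lemma HasConfig.meetsHalves_first (h : HasConfig Γ side T g s c) (hΓ : IsInterface Ω Γ side)
    (hnear : c = .V ∨ c = .III ∧ SomeCutNear Γ T g) (i : Fin 3) :
    T.MeetsHalves (closure (side s)) i := by
  by_cases hcase : c = .III ∧ g.perm i = 0
  · obtain ⟨rfl, hi⟩ := hcase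
    obtain ⟨e, he, D, ⟨hDΓ, hD⟩, hdist⟩ := (hnear.resolve_left nofun).2
    obtain ⟨-, h2, h3⟩ := parallelEdges_spec he
    have hsum := dist_add_dist_of_mem_segment hD
    refine g.meetsHalves_of_mem_segment (by rw [hi]; exact h3.symm) (segment_symm ℝ (g.vertex T e.1) _ ▸ hD) ?_
      ((h e.2).1 h2).1 (hΓ.subset_closure _ hDΓ)
    rw [dist_comm (g.vertex T e.2) (g.vertex T e.1), dist_comm (g.vertex T e.2) D]
    linarith
  · obtain ⟨b, b', hb, hb', hne⟩ := Config.exists_mem_firstVertices (hnear.imp_right And.left)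
      (g.perm i) fun h1 h2 => hcase ⟨h1, h2⟩
    exact g.meetsHalves_of_vertices hne ((h b).1 hb).1 ((h b').1 hb').1

end

/-! ### Mesh elements and the stability theorem -/

namespace CartesianMesh

variable (M : CartesianMesh)

lemma len_le_size (i : Fin 3) (k : Fin (M.n i)) : M.len i k ≤ M.size :=
  le_ciSup (f := fun e : (i : Fin 3) × Fin (M.n i) => M.len e.1 e.2)
    (Set.finite_range _).bddAbove ⟨i, k⟩

lemma len_pos (i : Fin 3) (k : Fin (M.n i)) : 0 < M.len i k :=
  sub_pos.2 (M.strictMono i Fin.castSucc_lt_succ)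

lemma mem_domain_of_forall_mem_Ioo (k : (i : Fin 3) → Fin (M.n i)) {X : E3}
    (hX : ∀ i, X i ∈ Set.Ioo ((M.element k).lo i) ((M.element k).hi i)) : X ∈ M.domain := by
  intro i
  have h1 : M.node i 0 ≤ (M.element k).lo i := (M.strictMono i).monotone (Fin.zero_le _)
  have h2 : (M.element k).hi i ≤ M.node i (Fin.last _) := (M.strictMono i).monotone (Fin.le_last _)
  exact ⟨h1.trans_lt (hX i).1, (hX i).2.trans_le h2⟩

end CartesianMesh

lemma IsAdmissibleTriangle.mem {Γ : Set E3} {side : Bool → Set E3} {T : Cuboid} {P : Fin 3 → E3}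
    (h : IsAdmissibleTriangle Γ side T P) (j : Fin 3) : P j ∈ Γ ∩ T.carrier := by
  obtain ⟨d, b, s, -, -, -, hΓ, he⟩ := h.interfacePoint j
  exact ⟨hΓ, T.edge_subset_carrier d b he⟩

lemma triCentroid_mem_carrier {T : Cuboid} {P : Fin 3 → E3} (hP : ∀ j, P j ∈ T.carrier) :
    triCentroid P ∈ T.carrier := by
  intro i
  have h0 := hP 0 i
  have h1 := hP 1 i
  have h2 := hP 2 i
  have h : triCentroid P i = 1 / 3 * (P 0 i + P 1 i + P 2 i) := by
    simp [triCentroid]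
    ring
  rw [Set.mem_Icc] at *
  rw [h]
  constructor <;> linarith [h0.1, h0.2, h1.1, h1.2, h2.1, h2.2]

end ImmersedFE

theorem mainTheorem5 (ρ : ℝ) :
    ∃ K : ℝ, 0 < K ∧
      ∀ (M : CartesianMesh) (Γ : Set E3) (side : Bool → Set E3) (βm βp : ℝ),
        M.ShapeRegular ρ → IsInterface M.domain Γ side → IsResolved M Γ →
        0 < βm → βm ≤ βp →
        ∀ (k : (i : Fin 3) → Fin (M.n i)) (P : Fin 3 → E3) (ν : E3),
          IsAdmissibleTriangle Γ side (M.element k) P → IsPlaneNormal P ν →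
          ∃ 𝒞 : Q1 ≃ₗ[ℝ] Q1, IsExtensionOperator βm βp P ν 𝒞 ∧
            ∀ (g : Labelling) (s : Bool) (c : Config),
              HasConfig Γ side (M.element k) g s c →
              ((c = .III → SomeCutFar Γ (M.element k) g) →
                IsStableOn K βm βp 𝒞 ((M.element k).carrier ∩ side (!s))) ∧
              ((c = .V ∨ c = .III ∧ SomeCutNear Γ (M.element k) g) →
                IsStableOn K βm βp 𝒞 ((M.element k).carrier ∩ side s)) := by
  rcases lt_or_ge ρ 1 with hρ | hρ
  · -- there are no such meshes, because an edge is not longer than `h`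
    refine ⟨1, one_pos, fun M Γ side βm βp hM _ _ _ _ k => ?_⟩
    have h1 := (M.len_le_size 0 (k 0)).trans (hM 0 (k 0))
    nlinarith [M.len_pos 0 (k 0)]
  have hρ0 : 0 < ρ := by linarith
  set r : ℝ := 1 / (1600 * ρ) with hr
  have hr0 : 0 < r := by positivity
  have hr1 : r ≤ 1 := by
    rw [hr, div_le_one (by positivity)]
    linarith
  have hI0 : 0 ≤ inverseConst r := by rw [inverseConst]; positivity
  refine ⟨√(2 + 384 * inverseConst r), by positivity, ?_⟩
  intro M Γ side βm βp hM hΓ hres hβm hβ k P ν hP hν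
  have hβp : 0 < βp := hβm.trans_le hβ
  set T := M.element k with hT
  set F := triCentroid P with hF
  have hle : ∀ i, T.hi i - T.lo i ≤ M.size := fun i => M.len_le_size i (k i)
  have hge : ∀ i, M.size ≤ ρ * (T.hi i - T.lo i) := fun i => hM i (k i)
  have hH : 0 < M.size := (M.len_pos 0 (k 0)).trans_le (M.len_le_size 0 (k 0))
  have hFT : F ∈ T.carrier := triCentroid_mem_carrier fun j => (hP.mem j).2
  have hab : βm / βp * (βp / βm) = 1 := by field_simp
  obtain ⟨S, hS, hsub, hSsub⟩ := hΓ.exists_separates rfl ⟨P 0, (hP.mem 0).1⟩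
  -- a side that meets all half cuboids contains a large ball, so that the operator is stable on it
  have hstable : ∀ s, (∀ i, T.MeetsHalves (closure (side s)) i) →
      IsStableOn √(2 + 384 * inverseConst r) βm βp
        (scaleNormalEquiv (F := F) hν.1 hab) (T.carrier ∩ side s) := by
    intro s hs
    obtain ⟨Z, hZS, hZT⟩ := hS.exists_ball_subset hΓ.surface hH hρ hle hge
      (hasDisjointNormals_of_lt_reach hres.reach_bound) (s := s) ⟨P 0, hP.mem 0⟩
      (fun i => by
        obtain ⟨Y, h1, h2, h3⟩ := (hs i).1
        exact ⟨Y, h1, closure_mono (hsub s) h2, h3⟩)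
      (fun i => by
        obtain ⟨Y, h1, h2, h3⟩ := (hs i).2
        exact ⟨Y, h1, closure_mono (hsub s) h2, h3⟩)
    have hrad : M.size / (1600 * ρ) = r * M.size := by rw [hr]; ring
    rw [hrad] at hZS hZT
    have hball : Metric.ball Z (r * M.size) ⊆ T.carrier ∩ side s := fun W hW =>
      ⟨fun i => Set.Ioo_subset_Icc_self (hZT W hW i),
        hSsub s ⟨hZS hW, M.mem_domain_of_forall_mem_Ioo k (hZT W hW)⟩⟩
    have hZ : Z ∈ T.carrier := (hball (Metric.mem_ball_self (by positivity))).1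
    have hTZ := Cuboid.carrier_subset_closedBall hH.le hle hZ
    have hmeas : MeasurableSet (T.carrier ∩ side s) :=
      T.isClosed_carrier.measurableSet.inter (hΓ.isOpen s).measurableSet
    have hmain : ∀ {a B : ℝ}, 1 ≤ B → |a - 1| ≤ B → ∀ (j : Fin 2) (p : Q1),
        sobolevSeminorm j (T.carrier ∩ side s) (scaleNormal F ν a p) ≤
          √(2 + 384 * inverseConst r) * B * sobolevSeminorm j (T.carrier ∩ side s) p :=
      fun hB haB j p => sobolevSeminorm_scaleNormal_le hν.1 hr0 hr1 hH
        (Set.inter_subset_left.trans hTZ) hball (mem_closedBall_iff_norm.1 (hTZ hFT)) hmeas hB haB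
        j p
    intro j p
    constructor
    · have h1 : 0 ≤ βm / βp := by positivity
      have h2 : βm / βp ≤ 1 := (div_le_one hβp).2 hβ
      have := hmain le_rfl (a := βm / βp) (by rw [abs_le]; constructor <;> linarith) j p
      rwa [mul_one] at this
    · have h1 : 1 ≤ βp / βm := (one_le_div hβm).2 hβ
      exact hmain h1 (a := βp / βm) (by rw [abs_le]; constructor <;> linarith) j p
  refine ⟨scaleNormalEquiv (F := F) hν.1 hab,
    isExtensionOperator_scaleNormalEquiv hP.affineIndependent hν hβp.ne' hab,
    fun g s c hc => ⟨fun hfar => ?_, fun hnear => ?_⟩⟩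
  · exact hstable (!s) fun i => hc.meetsHalves_last hΓ hfar i
  · exact hstable s fun i => hc.meetsHalves_first hΓ hnear i
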